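/- Let $\mathrm{PSL}_2(\mathbb Z)=\langle a,b\mid a^2=b^3=1\rangle$, where $a$ and $b$ are the classes of $\begin{pmatrix}0&-1\\1&0\end{pmatrix}$ and $\begin{pmatrix}0&-1\\1&1\end{pmatrix}$, and let $H$ be a finitely generated subgroup. Definitions. The Schreier graph of $H$ has the cosets $Hg$ as vertices, with an edge labeled $c$ from $Hg$ to $Hgc$ for every $g\in\mathrm{PSL}_2(\mathbb Z)$ and $c\in\{a,b\}$. The Stallings graph $\Gamma(H)$ is its subgraph consisting of the vertices and edges on the loops at the base vertex $H$ that are labeled by geodesic words over $\{a^{\pm1},b^{\pm1}\}$ (a word is geodesic if it is a shortest word representing its value; a letter $c^{-1}$ traverses a $c$-edge backwards). A finite graph with edges labeled $a$ or $b$ and with a base vertex is *reduced* if (1) it is connected and no two edges with the same label leave, or enter, the same vertex; (2) for every $a$-edge $p\to q$ there is an $a$-edge $q\to p$; (3) for all $b$-edges $p\to q$ and $q\to r$ there is a $b$-edge $r\to p$ (forming a $b$-triangle if $p,q,r$ are distinct); (4) every vertex, except possibly the base vertex, is adjacent to an $a$-edge and to a $b$-edge. A graph is *cyclically reduced* if it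 is reduced for every choice of the base vertex. The *combinatorial type* of $H$ is $(n,k_2,k_3,\ell_2,\ell_3,m)$, where $n$ is the number of vertices of $\Gamma(H)$, $k_2$ is the number of isolated $a$-edges (pairs of opposite $a$-edges between two distinct vertices, each pair counted once), $k_3$ is the number of isolated $b$-edges (those that are neither loops nor in a $b$-triangle), $\ell_2$ and $\ell_3$ are the numbers of $a$-loops and of $b$-loops, and $m$ is the number of $b$-triangles. The *isomorphism type* of $H$ is the unique triple $(\lambda_2,\lambda_3,r)$ of natural numbers such that $H$ is isomorphic to the free product of $\lambda_2$ copies of $\mathbb Z/2$, $\lambda_3$ copies of $\mathbb Z/3$ and a free group of rank $r$. **Proposition.** Let $H$ be a finitely generated subgroup of $\mathrm{PSL}_2(\mathbb Z)$ of combinatorial type $(n,k_2,k_3,\ell_2,\ell_3,m)$ with $n\ge 2$. If $\Gamma(H)$ is cyclically reduced, then: - the isomorphism type of $H$ is $\left(\ell_2,\ell_3,\frac{n-2k_3-3\ell_2-4\ell_3}{6}+1\right)$, and it is $\left(\ell_2,\ell_3,\frac{n-3\ell_2-4\ell_3}{6}+1\right)$ if $H$ has finite index; - $H$ is free if and only if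 $\ell_2=\ell_3=0$; in that case $H$ has rank $\frac{n-2k_3}{6}+1$, and rank $\frac n6+1$ if $H$ has finite index. If $\Gamma(H)$ is not cyclically reduced, then the base vertex of $\Gamma(H)$ is either adjacent to an $a$-edge or to a $b$-edge, but not to both, and: - the isomorphism type of $H$ is $\left(\ell_2,\ell_3,\frac{n-2k_3-3\ell_2-4\ell_3}{6}+\frac13\right)$ if the base vertex is adjacent to an $a$-edge, and $\left(\ell_2,\ell_3,\frac{n-2k_3-3\ell_2-4\ell_3}{6}+\frac12\right)$ if it is adjacent to a $b$-edge; - $H$ is free if and only if $\ell_2=\ell_3=0$; in that case $H$ has rank $\frac16(n-2k_3+2)$ if the base vertex is adjacent to an $a$-edge, and $\frac16(n-2k_3+3)$ if it is adjacent to a $b$-edge. -/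

import Mathlib

namespace ModularSubgroups

/-- The modular group `PSL₂(ℤ)`. -/
abbrev PSL2Z : Type := Matrix.ProjectiveSpecialLinearGroup (Fin 2) ℤ

/-- The alphabet `A = {a, b}`. -/
inductive Letter : Type
  | a
  | b

/-- The standard generators of `PSL₂(ℤ) = ⟨a, b ∣ a² = b³ = 1⟩`: `a` is the class of the matrix
`S = (0, -1; 1, 0)` and `b` is the class of the matrix `S * T = (0, -1; 1, 1)`. -/
def gen : Letter → PSL2Z
  | Letter.a => QuotientGroup.mk ModularGroup.S
  | Letter.b => QuotientGroup.mk (ModularGroup.S * ModularGroup.T)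

/-- Words over the alphabet `A ⊔ A⁻¹`; `(c, true)` is the letter `c` and `(c, false)` is the
letter `c⁻¹`. -/
abbrev Word : Type := List (Letter × Bool)

/-- The element of `PSL₂(ℤ)` represented by a letter of `A ⊔ A⁻¹`. -/
def letterValue (x : Letter × Bool) : PSL2Z :=
  if x.2 then gen x.1 else (gen x.1)⁻¹

/-- The element of `PSL₂(ℤ)` represented by a word. -/
def wordValue (w : Word) : PSL2Z := (w.map letterValue).prod

/-- A word is geodesic if it is a shortest word representing its value. -/
def IsGeodesic (w : Word) : Prop :=
  ∀ w' : Word, wordValue w' = wordValue w → w.length ≤ w'.length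

/-- Directed graphs with vertices in `V` and edges labeled by `A`. Finiteness is not built in (the
Schreier graph may be infinite), it is part of `IsReduced` below. -/
structure LabeledGraph (V : Type*) where
  /-- the vertex set -/
  verts : Set V
  /-- `edge c p q`: there is a `c`-labeled edge from `p` to `q` -/
  edge : Letter → V → V → Prop
  left_mem : ∀ {c p q}, edge c p q → p ∈ verts
  right_mem : ∀ {c p q}, edge c p q → q ∈ verts

namespace LabeledGraph

variable {V : Type*} (G : LabeledGraph V)

/-- Traversing an edge labeled by a letter of `A ⊔ A⁻¹`: the letter `c⁻¹` traverses a `c`-edge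
backwards. -/
def Step (x : Letter × Bool) (p q : V) : Prop :=
  if x.2 then G.edge x.1 p q else G.edge x.1 q p

/-- `G.IsPath p w q`: there is a path from `p` to `q` labeled by the word `w`. -/
inductive IsPath : V → Word → V → Prop
  | nil {p : V} : p ∈ G.verts → IsPath p [] p
  | snoc {p q r : V} {w : Word} {x : Letter × Bool} :
      IsPath p w q → G.Step x q r → IsPath p (w ++ [x]) r

theorem IsPath.cons {G : LabeledGraph V} {p q r : V} {x : Letter × Bool} {w : Word} (hp : p ∈ G.verts)
    (hs : G.Step x p q) (h : G.IsPath q w r) : G.IsPath p (x :: w) r := by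
  induction h with
  | nil _ => exact .snoc (w := []) (.nil hp) hs
  | snoc _ h ih => exact .snoc ih h

/-- The vertex `p` is adjacent to a `c`-edge (incoming or outgoing). -/
def IsAdjacent (c : Letter) (p : V) : Prop :=
  ∃ q, G.edge c p q ∨ G.edge c q p

/-- No two edges out of (resp. into) the same vertex have the same label. -/
def IsFreelyReduced : Prop :=
  (∀ c p q r, G.edge c p q → G.edge c p r → q = r) ∧
  (∀ c p q r, G.edge c q p → G.edge c r p → q = r)

/-- Any two vertices are joined by an undirected path. -/
def IsConnected : Prop :=
  G.verts.Nonempty ∧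
  ∀ p ∈ G.verts, ∀ q ∈ G.verts, Relation.EqvGen (fun x y => ∃ c, G.edge c x y) p q

/-- `PSL₂(ℤ)`-reduced graphs, rooted at the vertex `v`. -/
structure IsReduced (v : V) : Prop where
  base_mem : v ∈ G.verts
  finite : G.verts.Finite
  connected : G.IsConnected
  freelyReduced : G.IsFreelyReduced
  a_symm : ∀ p q, G.edge Letter.a p q → G.edge Letter.a q p
  b_triangle : ∀ p q r, G.edge Letter.b p q → G.edge Letter.b q r → G.edge Letter.b r p
  adjacent : ∀ p ∈ G.verts, p ≠ v → G.IsAdjacent Letter.a p ∧ G.IsAdjacent Letter.b p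

/-- An unrooted graph is `PSL₂(ℤ)`-cyclically reduced if it is `PSL₂(ℤ)`-reduced for every choice
of a base vertex. -/
def IsCyclicallyReduced : Prop :=
  G.verts.Nonempty ∧ ∀ v ∈ G.verts, G.IsReduced v

end LabeledGraph

/-- Combinatorial types `(n, k₂, k₃, ℓ₂, ℓ₃, m)`. -/
@[ext]
structure CombinatorialType : Type where
  n : ℕ
  k₂ : ℕ
  k₃ : ℕ
  l₂ : ℕ
  l₃ : ℕ
  m : ℕ

namespace LabeledGraph

variable {V : Type*} (G : LabeledGraph V)

/-- The isolated `a`-edges: pairs of distinct vertices with `a`-edges both ways between them, each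
such pair being counted once. -/
def isolatedAEdges : Set (Set V) :=
  {s | ∃ p q, p ≠ q ∧ G.edge Letter.a p q ∧ G.edge Letter.a q p ∧ s = {p, q}}

/-- The `b`-triangles, as sets of three vertices. -/
def bTriangles : Set (Set V) :=
  {s | ∃ p q r, p ≠ q ∧ q ≠ r ∧ r ≠ p ∧
    G.edge Letter.b p q ∧ G.edge Letter.b q r ∧ G.edge Letter.b r p ∧ s = {p, q, r}}

/-- The isolated `b`-edges: the `b`-edges that are neither loops nor in a `b`-triangle. -/
def isolatedBEdges : Set (V × V) :=
  {e | G.edge Letter.b e.1 e.2 ∧ e.1 ≠ e.2 ∧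
    ¬ ∃ r, r ≠ e.1 ∧ r ≠ e.2 ∧ G.edge Letter.b e.2 r ∧ G.edge Letter.b r e.1}

/-- The loops labeled `c`, identified with the vertices carrying them. -/
def loops (c : Letter) : Set V := {p | G.edge c p p}

/-- The combinatorial type of a (finite) graph. -/
noncomputable def combinatorialType : CombinatorialType where
  n := G.verts.ncard
  k₂ := G.isolatedAEdges.ncard
  k₃ := G.isolatedBEdges.ncard
  l₂ := (G.loops Letter.a).ncard
  l₃ := (G.loops Letter.b).ncard
  m := G.bTriangles.ncard

end LabeledGraph

section Stallings

variable (H : Subgroup PSL2Z)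

/-- The set of right cosets `H g`. -/
abbrev Cosets : Type := Quotient (QuotientGroup.rightRel H)

/-- The right coset `H g`. -/
def coset (g : PSL2Z) : Cosets H := Quotient.mk (QuotientGroup.rightRel H) g

/-- The base vertex, the coset `H`. -/
def base : Cosets H := coset H 1

/-- The Schreier graph: the vertices are the cosets `H g`, with a `c`-edge from `H g` to `H g c`
for every `g` in `PSL₂(ℤ)` and `c` in `{a, b}`. -/
def schreierGraph : LabeledGraph (Cosets H) where
  verts := Set.univ
  edge c p q := ∃ g : PSL2Z, p = coset H g ∧ q = coset H (g * gen c)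
  left_mem _ := Set.mem_univ _
  right_mem _ := Set.mem_univ _

/-- The Stallings graph `Γ(H)`: the subgraph of the Schreier graph spanned by (that is, consisting
of all the vertices and edges on) the loops at the vertex `H` that are labeled by geodesic words.
A loop through a vertex or an edge is cut there into an initial part, labeled `u`, and a final
part, labeled `v`; the edge may be traversed forwards or backwards. -/
def stallingsGraph : LabeledGraph (Cosets H) where
  verts := {p | ∃ u v : Word, IsGeodesic (u ++ v) ∧
    (schreierGraph H).IsPath (base H) u p ∧ (schreierGraph H).IsPath p v (base H)}
  edge c p q := (schreierGraph H).edge c p q ∧ ∃ u v : Word,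
    (IsGeodesic (u ++ (c, true) :: v) ∧
      (schreierGraph H).IsPath (base H) u p ∧ (schreierGraph H).IsPath q v (base H)) ∨
    (IsGeodesic (u ++ (c, false) :: v) ∧
      (schreierGraph H).IsPath (base H) u q ∧ (schreierGraph H).IsPath p v (base H))
  left_mem := by
    rintro c p q ⟨he, u, v, ⟨hg, hu, hv⟩ | ⟨hg, hu, hv⟩⟩
    · exact ⟨u, (c, true) :: v, hg, hu, LabeledGraph.IsPath.cons (by simp [schreierGraph]) (by simpa [LabeledGraph.Step] using he) hv⟩
    · exact ⟨u ++ [(c, false)], v, by simpa using hg,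
        .snoc hu (by simpa [LabeledGraph.Step] using he), hv⟩
  right_mem := by
    rintro c p q ⟨he, u, v, ⟨hg, hu, hv⟩ | ⟨hg, hu, hv⟩⟩
    · exact ⟨u ++ [(c, true)], v, by simpa using hg,
        .snoc hu (by simpa [LabeledGraph.Step] using he), hv⟩
    · exact ⟨u, (c, false) :: v, hg, hu, LabeledGraph.IsPath.cons (by simp [schreierGraph]) (by simpa [LabeledGraph.Step] using he) hv⟩

end Stallings

/-- The free product of `l` copies of the group `C`. -/
abbrev FreePower (C : Type) [Group C] (l : ℕ) : Type :=
  Monoid.CoprodI fun _ : Fin l => C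

/-- The free product of three groups. -/
abbrev FreeProduct (G₁ G₂ G₃ : Type) [Group G₁] [Group G₂] [Group G₃] : Type :=
  Monoid.Coprod G₁ (Monoid.Coprod G₂ G₃)

/-- The free product of `l₂` copies of the cyclic group of order 2, `l₃` copies of the cyclic group
of order 3, and a free group of rank `r`. -/
abbrev FreeProductModel (l₂ l₃ r : ℕ) : Type :=
  FreeProduct (FreePower (Multiplicative (ZMod 2)) l₂) (FreePower (Multiplicative (ZMod 3)) l₃)
    (FreeGroup (Fin r))

/-- The isomorphism type of `G` is `(l₂, l₃, r)`, where `r` is a rational number: `r` is a natural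
number, `G` is isomorphic to the free product of `l₂` groups of order 2, `l₃` groups of order 3 and
a free group of rank `r`, and `(l₂, l₃, r)` is the only triple with this property. -/
def IsomorphismTypeIs (G : Type*) [Group G] (l₂ l₃ : ℕ) (r : ℚ) : Prop :=
  ∃ r₀ : ℕ, (r₀ : ℚ) = r ∧ ∀ l₂' l₃' r' : ℕ,
    Nonempty (G ≃* FreeProductModel l₂' l₃' r') ↔ l₂' = l₂ ∧ l₃' = l₃ ∧ r' = r₀

/-- `G` is a free group of rank `r` (in particular the rational number `r` is a natural number). -/
def IsFreeOfRank (G : Type*) [Group G] (r : ℚ) : Prop :=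
  ∃ r₀ : ℕ, (r₀ : ℚ) = r ∧ Nonempty (FreeGroupBasis (Fin r₀) G)

end ModularSubgroups

/-! ### The modular group as the free product of ℤ/2 and ℤ/3. -/

namespace ModularSubgroups

open Monoid Matrix

/-! The modular group is the free product of ⟨a⟩ ≅ ℤ/2 and ⟨b⟩ ≅ ℤ/3 (`fromCoprod_injective`, by
ping-pong), so the geodesic words are exactly the words alternating between a^{±1} and b^{±1}. This
makes Γ(H) a local object: with `Reach c p` expressing that p is reached from the base by an
alternating word not ending in c^{±1}, a c-edge of the Schreier graph lies in Γ(H) iff `Reach c`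
holds at both ends, and a vertex iff it satisfies `Reach` for both letters (`stallings_edge`,
`stallings_verts`).

The structure of H is Kurosh's theorem with an explicit basis
(`nonempty_mulEquiv_freeProductModel`). In each orbit of a generator on the cosets a root nearest to
the base is chosen; following roots towards the base gives a transversal. A coset fixed by a or b
contributes a conjugate of ⟨a⟩ or ⟨b⟩, and a coset that is the root of neither of its two orbits
closes a cycle and contributes a free generator. Let M be the abstract free product on these data
and ψ : M → PSL₂(ℤ) the evident map. The modular group acts on M × (cosets) through a cocycle, the
action being defined as soon as a² = b³ = 1 holds orbit by orbit; reading off the M-coordinate of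
the translates of (1, base) inverts ψ on H.

The rank r of the free factor is then an Euler characteristic. The base is the only coset that is a
root for both letters, and a coset outside Γ(H) is a root for some letter, so r + #(a-roots) +
#(b-roots) = n + 1, the roots being counted in Γ(H). Let δ_c be 1 if the base has no c-edge and 0
otherwise. Then n = ℓ₂ + 2k₂ + δ_a = ℓ₃ + 3m + 2k₃ + δ_b, with ℓ₂ + k₂ + δ_a roots for a and ℓ₃ + m
+ k₃ + δ_b roots for b. Eliminating k₂ and m gives r (`exists_mulEquiv_rank`). For n ≥ 2 at most one
δ_c is 1, and Γ(H) is cyclically reduced iff both vanish; finite index forces k₃ = 0. Uniqueness of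
the type follows from counting homomorphisms to ℤ/2, ℤ/3 and ℤ/5. -/

/-- The homomorphism from the cyclic group of order `n` sending the generator to `k`. -/
def cyclicLift {K : Type*} [Group K] (n : ℕ) (k : K) (hk : k ^ n = 1) :
    Multiplicative (ZMod n) →* K :=
  AddMonoidHom.toMultiplicativeLeft
    (ZMod.lift n ⟨(zmultiplesHom (Additive K)) (Additive.ofMul k), by
      simpa using congrArg Additive.ofMul hk⟩)

theorem cyclicLift_intCast {K : Type*} [Group K] (n : ℕ) (k : K) (hk : k ^ n = 1) (j : ℤ) :
    cyclicLift n k hk (Multiplicative.ofAdd (j : ZMod n)) = k ^ j := by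
  change Additive.toMul (ZMod.lift n _ (j : ZMod n)) = k ^ j
  rw [ZMod.lift_coe]
  rfl

@[simp]
theorem cyclicLift_one {K : Type*} [Group K] (n : ℕ) (k : K) (hk : k ^ n = 1) :
    cyclicLift n k hk (Multiplicative.ofAdd 1) = k := by
  simpa only [Int.cast_one, zpow_one] using cyclicLift_intCast n k hk 1

theorem cyclicLift_neg_one {K : Type*} [Group K] (n : ℕ) (k : K) (hk : k ^ n = 1) :
    cyclicLift n k hk (Multiplicative.ofAdd (-1)) = k⁻¹ := by
  simpa only [Int.cast_neg, Int.cast_one, _root_.zpow_neg, zpow_one] using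
    cyclicLift_intCast n k hk (-1)

theorem cyclicHom_ext {K : Type*} [Group K] {n : ℕ} {f g : Multiplicative (ZMod n) →* K}
    (h : f (Multiplicative.ofAdd 1) = g (Multiplicative.ofAdd 1)) : f = g := by
  refine MonoidHom.ext fun x => ?_
  obtain ⟨j, hj⟩ := ZMod.intCast_surjective (Multiplicative.toAdd x)
  have hx : x = (Multiplicative.ofAdd (1 : ZMod n)) ^ j := by
    rw [← ofAdd_zsmul]; simp [hj]
  rw [hx, map_zpow, map_zpow, h]

/-- The order of a generator of the modular group. -/
def letterOrder : Letter → ℕ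
  | Letter.a => 2
  | Letter.b => 3

/-- Both S² and (ST)³ are the scalar matrix -1, which is trivial in PSL₂(ℤ). -/
theorem gen_a_sq : gen Letter.a ^ 2 = 1 := by
  change QuotientGroup.mk (ModularGroup.S ^ 2) = _
  rw [QuotientGroup.eq_one_iff, Matrix.SpecialLinearGroup.mem_center_iff]
  refine ⟨-1, by simp, ?_⟩
  ext i j
  fin_cases i <;> fin_cases j <;> simp [ModularGroup.coe_S,
    Matrix.SpecialLinearGroup.coe_mul, pow_two, Matrix.mul_apply]

theorem gen_b_cube : gen Letter.b ^ 3 = 1 := by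
  change QuotientGroup.mk ((ModularGroup.S * ModularGroup.T) ^ 3) = _
  rw [QuotientGroup.eq_one_iff, Matrix.SpecialLinearGroup.mem_center_iff]
  refine ⟨-1, by simp, ?_⟩
  ext i j
  fin_cases i <;> fin_cases j <;> simp [ModularGroup.coe_S,
    ModularGroup.coe_T, Matrix.SpecialLinearGroup.coe_mul, pow_succ, Matrix.mul_apply]

theorem gen_pow_letterOrder : ∀ c, gen c ^ letterOrder c = 1
  | Letter.a => gen_a_sq
  | Letter.b => gen_b_cube

/-- The canonical map from the free product `ℤ/2 * ℤ/3` to the modular group. -/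
def fromCoprod : CoprodI (fun c => Multiplicative (ZMod (letterOrder c))) →* PSL2Z :=
  CoprodI.lift fun c => cyclicLift (letterOrder c) (gen c) (gen_pow_letterOrder c)

/-- The product of the entries of the first column, an invariant of a class modulo `±1`. -/
def columnProd (g : PSL2Z) : ℤ :=
  Quotient.liftOn' g (fun A : SpecialLinearGroup (Fin 2) ℤ => A 0 0 * A 1 0) (by
    intro A B h
    rw [QuotientGroup.leftRel_apply, Matrix.SpecialLinearGroup.mem_center_iff] at h
    obtain ⟨r, hr, h⟩ := h
    have hB : (B : Matrix (Fin 2) (Fin 2) ℤ) = A * Matrix.scalar (Fin 2) r := by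
      rw [h, ← Matrix.SpecialLinearGroup.coe_mul, mul_inv_cancel_left]
    have hr' : r * r = 1 := by simpa [pow_two] using hr
    simp only [hB, Matrix.mul_apply, Fin.sum_univ_two, Matrix.scalar_apply, Matrix.diagonal_apply]
    simp
    -- Passing to another representative scales the column by r with r² = 1, so the product is
    -- unchanged.
    linear_combination -(A 0 0 * A 1 0) * hr')

theorem columnProd_mk (A : SpecialLinearGroup (Fin 2) ℤ) :
    columnProd (QuotientGroup.mk A) = A 0 0 * A 1 0 := rfl

/-- Left multiplication by a turns the first column (p, q) into (-q, p), with product -pq. -/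
theorem columnProd_gen_a_mul (g : PSL2Z) (h : columnProd g < 0) :
    0 < columnProd (gen Letter.a * g) := by
  induction g using QuotientGroup.induction_on with | _ A
  rw [columnProd_mk] at h
  change 0 < columnProd (QuotientGroup.mk (ModularGroup.S * A))
  rw [columnProd_mk]
  simp [Matrix.SpecialLinearGroup.coe_mul, ModularGroup.coe_S, Matrix.mul_apply, Fin.sum_univ_two]
  linarith

/-- The column (p, q) becomes (-q, p + q), with product -pq - q². For b⁻¹ below it becomes (p + q,
-p), with product -p² - pq. -/
theorem columnProd_gen_b_mul (g : PSL2Z) (h : 0 < columnProd g) :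
    columnProd (gen Letter.b * g) < 0 := by
  induction g using QuotientGroup.induction_on with | _ A
  rw [columnProd_mk] at h
  change columnProd (QuotientGroup.mk (ModularGroup.S * ModularGroup.T * A)) < 0
  rw [columnProd_mk]
  simp [Matrix.SpecialLinearGroup.coe_mul, ModularGroup.coe_S, ModularGroup.coe_T, Matrix.mul_apply,
    Fin.sum_univ_two]
  nlinarith [sq_nonneg (A 1 0)]

theorem columnProd_gen_b_inv_mul (g : PSL2Z) (h : 0 < columnProd g) :
    columnProd ((gen Letter.b)⁻¹ * g) < 0 := by
  induction g using QuotientGroup.induction_on with | _ A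
  rw [columnProd_mk] at h
  change columnProd (QuotientGroup.mk ((ModularGroup.S * ModularGroup.T)⁻¹ * A)) < 0
  rw [columnProd_mk]
  simp [Matrix.SpecialLinearGroup.coe_mul, ModularGroup.coe_S, ModularGroup.coe_T, Matrix.mul_apply,
    Fin.sum_univ_two, Matrix.adjugate_fin_two]
  nlinarith [sq_nonneg (A 0 0)]

instance : Nontrivial Letter := ⟨Letter.a, Letter.b, by simp⟩

/-- Ping-pong on the group itself: a sends the classes of negative `columnProd` to those of positive
one, and b^{±1} send positive to negative. With only two factors, one of them must have at least
three elements. -/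
theorem fromCoprod_injective : Function.Injective fromCoprod := by
  refine CoprodI.lift_injective_of_ping_pong (α := PSL2Z) _ ?_
    (fun c => match c with
      | Letter.a => {g | 0 < columnProd g}
      | Letter.b => {g | columnProd g < 0}) ?_ ?_ ?_
  · right
    refine ⟨Letter.b, ?_⟩
    change 3 ≤ Cardinal.mk (ZMod 3)
    simp [Cardinal.mk_fintype, ZMod.card]
  · have h1 : 0 < columnProd (QuotientGroup.mk
        (⟨!![2, 1; 1, 1], by simp [Matrix.det_fin_two]⟩ : SpecialLinearGroup (Fin 2) ℤ)) := by
      change (0 : ℤ) < 2 * 1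
      norm_num
    rintro (_ | _)
    · exact ⟨_, h1⟩
    · exact ⟨_, columnProd_gen_b_mul _ h1⟩
  · rintro (_ | _) (_ | _) h
    · exact (h rfl).elim
    · exact Set.disjoint_left.2 fun g (h1 : 0 < columnProd g) (h2 : columnProd g < 0) =>
        lt_asymm h1 h2
    · exact Set.disjoint_left.2 fun g (h1 : columnProd g < 0) (h2 : 0 < columnProd g) =>
        lt_asymm h1 h2
    · exact (h rfl).elim
  · have h2 : ∀ h : Multiplicative (ZMod 2), h ≠ 1 → h = Multiplicative.ofAdd 1 := by decide
    have h3 : ∀ h : Multiplicative (ZMod 3), h ≠ 1 →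
        h = Multiplicative.ofAdd 1 ∨ h = Multiplicative.ofAdd (-1) := by decide
    rintro (_ | _) (_ | _) hij
    · exact (hij rfl).elim
    · intro h hh
      rw [h2 h hh]
      rintro _ ⟨g, hg, rfl⟩
      have := columnProd_gen_a_mul g hg
      change 0 < columnProd (cyclicLift 2 (gen Letter.a) gen_a_sq _ * g)
      rwa [cyclicLift_one]
    · intro h hh
      rintro _ ⟨g, hg, rfl⟩
      rcases h3 h hh with rfl | rfl
      · have := columnProd_gen_b_mul g hg
        change columnProd (cyclicLift 3 (gen Letter.b) gen_b_cube _ * g) < 0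
        rwa [cyclicLift_one]
      · have := columnProd_gen_b_inv_mul g hg
        change columnProd (cyclicLift 3 (gen Letter.b) gen_b_cube _ * g) < 0
        rwa [cyclicLift_neg_one]
    · exact (hij rfl).elim

theorem closure_gen : Subgroup.closure (Set.range gen) = ⊤ := by
  rw [eq_top_iff]
  have hS : gen Letter.a ∈ Subgroup.closure (Set.range gen) := Subgroup.subset_closure ⟨_, rfl⟩
  have hT : (QuotientGroup.mk ModularGroup.T : PSL2Z) ∈ Subgroup.closure (Set.range gen) := by
    have : (QuotientGroup.mk ModularGroup.T : PSL2Z) = (gen Letter.a)⁻¹ * gen Letter.b := by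
      change _ = QuotientGroup.mk (ModularGroup.S⁻¹ * (ModularGroup.S * ModularGroup.T))
      rw [inv_mul_cancel_left]
    rw [this]
    exact mul_mem (inv_mem hS) (Subgroup.subset_closure ⟨_, rfl⟩)
  rintro g -
  induction g using QuotientGroup.induction_on with | _ A
  have hA : A ∈ Subgroup.closure {ModularGroup.S, ModularGroup.T} := by
    rw [SpecialLinearGroup.SL2Z_generators]; trivial
  induction hA using Subgroup.closure_induction with
  | mem x hx =>
    rcases hx with rfl | rfl
    · exact hS
    · exact hT
  | one => exact one_mem _
  | mul x y _ _ hx hy => exact mul_mem hx hy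
  | inv x _ hx => exact inv_mem hx

theorem fromCoprod_surjective : Function.Surjective fromCoprod := by
  rw [← MonoidHom.range_eq_top, eq_top_iff, ← closure_gen, Subgroup.closure_le]
  rintro _ ⟨c, rfl⟩
  exact ⟨CoprodI.of (i := c) (Multiplicative.ofAdd 1), by simp [fromCoprod]⟩

/-- The modular group is presented by `⟨a, b ∣ a² = b³ = 1⟩`. -/
theorem exists_hom {P : Type*} [Group P] (x : Letter → P) (hx : ∀ c, x c ^ letterOrder c = 1) :
    ∃ f : PSL2Z →* P, ∀ c, f (gen c) = x c := by
  let e := MulEquiv.ofBijective fromCoprod ⟨fromCoprod_injective, fromCoprod_surjective⟩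
  refine ⟨(CoprodI.lift fun c => cyclicLift (letterOrder c) (x c) (hx c)).comp
    e.symm.toMonoidHom, fun c => ?_⟩
  have : e.symm (gen c) = CoprodI.of (i := c) (Multiplicative.ofAdd 1) := by
    rw [MulEquiv.symm_apply_eq]
    simp [e, fromCoprod]
  simp [this]

/-- A word is alternating if neighbouring letters are distinct, whatever their signs. -/
def IsAlternating (w : Word) : Prop := w.IsChain fun x y => x.1 ≠ y.1

/-- The normal form in the free product given by an alternating word. -/
def IsAlternating.normalForm {w : Word} (hw : IsAlternating w) :
    CoprodI.Word (fun c => Multiplicative (ZMod (letterOrder c))) where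
  toList := w.map fun x => ⟨x.1, Multiplicative.ofAdd (if x.2 then 1 else -1)⟩
  ne_one := by
    simp only [List.mem_map]
    rintro _ ⟨⟨_ | _, _ | _⟩, _, rfl⟩
    · exact (by decide : Multiplicative.ofAdd (-1 : ZMod 2) ≠ 1)
    · exact (by decide : Multiplicative.ofAdd (1 : ZMod 2) ≠ 1)
    · exact (by decide : Multiplicative.ofAdd (-1 : ZMod 3) ≠ 1)
    · exact (by decide : Multiplicative.ofAdd (1 : ZMod 3) ≠ 1)
  chain_ne := by
    rw [List.isChain_map]
    exact hw

theorem IsAlternating.fromCoprod_prod {w : Word} (hw : IsAlternating w) :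
    fromCoprod hw.normalForm.prod = wordValue w := by
  rw [CoprodI.Word.prod, map_list_prod, wordValue]
  simp only [normalForm, List.map_map]
  congr 1
  refine List.map_congr_left fun x _ => ?_
  rcases x with ⟨c, _ | _⟩
  · simp [fromCoprod, letterValue]
  · simp [fromCoprod, letterValue]

/-- Uniqueness of normal forms in a free product. Only the length is determined, not the word, since
a and a⁻¹ give the same syllable. -/
theorem IsAlternating.length_eq {w w' : Word} (hw : IsAlternating w) (hw' : IsAlternating w')
    (h : wordValue w = wordValue w') : w.length = w'.length := by
  classical
  rw [← hw.fromCoprod_prod, ← hw'.fromCoprod_prod] at h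
  have h1 : hw.normalForm = hw'.normalForm :=
    CoprodI.Word.equiv.symm.injective (fromCoprod_injective h)
  simpa [normalForm] using congrArg (fun v => v.toList.length) h1

end ModularSubgroups

/-! ### Uniqueness of the isomorphism type, and freeness of the model. -/

namespace ModularSubgroups

open Monoid

/-- Homomorphisms from a cyclic group of order `n` are elements with trivial `n`-th power. -/
def cyclicHomEquiv (n : ℕ) (K : Type*) [Group K] :
    (Multiplicative (ZMod n) →* K) ≃ {k : K // k ^ n = 1} where
  toFun f := ⟨f (Multiplicative.ofAdd 1), by rw [← map_pow, ← ofAdd_nsmul]; simp⟩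
  invFun k := cyclicLift n k.1 k.2
  left_inv f := cyclicHom_ext (by simp)
  right_inv k := by simp

theorem card_freePower_hom (C : Type) [Group C] (l : ℕ) (K : Type) [Group K] :
    Nat.card (FreePower C l →* K) = Nat.card (C →* K) ^ l := by
  rw [← Nat.card_congr (CoprodI.lift (M := fun _ : Fin l => C) (N := K)), Nat.card_fun]
  simp

theorem card_freeProductModel_hom (l₂ l₃ r : ℕ) (K : Type) [Group K] :
    Nat.card (FreeProductModel l₂ l₃ r →* K) =
      Nat.card {k : K // k ^ 2 = 1} ^ l₂ * (Nat.card {k : K // k ^ 3 = 1} ^ l₃ *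
        Nat.card K ^ r) := by
  rw [← Nat.card_congr Coprod.liftEquiv, Nat.card_prod, ← Nat.card_congr Coprod.liftEquiv,
    Nat.card_prod, card_freePower_hom, card_freePower_hom, Nat.card_congr (cyclicHomEquiv 2 K),
    Nat.card_congr (cyclicHomEquiv 3 K), ← Nat.card_congr (FreeGroup.lift (α := Fin r) (β := K)),
    Nat.card_fun, Nat.card_fin]

/-- The numbers of homomorphisms to ℤ/2, ℤ/3 and ℤ/5 are 2^(l₂ + r), 3^(l₃ + r) and 5^r, and these
determine the triple. -/
theorem freeProductModel_unique {l₂ l₃ r l₂' l₃' r' : ℕ}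
    (e : FreeProductModel l₂ l₃ r ≃* FreeProductModel l₂' l₃' r') :
    l₂ = l₂' ∧ l₃ = l₃' ∧ r = r' := by
  have h (K : Type) [Group K] := (card_freeProductModel_hom l₂ l₃ r K).symm.trans
    ((Nat.card_congr e.monoidHomCongrLeftEquiv).trans (card_freeProductModel_hom l₂' l₃' r' K))
  have h2 := h (Multiplicative (ZMod 2))
  have h3 := h (Multiplicative (ZMod 3))
  have h5 := h (Multiplicative (ZMod 5))
  simp only [Nat.card_eq_fintype_card] at h2 h3 h5
  rw [show Fintype.card {k : Multiplicative (ZMod 2) // k ^ 2 = 1} = 2 by decide,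
    show Fintype.card {k : Multiplicative (ZMod 2) // k ^ 3 = 1} = 1 by decide,
    show Fintype.card (Multiplicative (ZMod 2)) = 2 by decide] at h2
  rw [show Fintype.card {k : Multiplicative (ZMod 3) // k ^ 2 = 1} = 1 by decide,
    show Fintype.card {k : Multiplicative (ZMod 3) // k ^ 3 = 1} = 3 by decide,
    show Fintype.card (Multiplicative (ZMod 3)) = 3 by decide] at h3
  rw [show Fintype.card {k : Multiplicative (ZMod 5) // k ^ 2 = 1} = 1 by decide,
    show Fintype.card {k : Multiplicative (ZMod 5) // k ^ 3 = 1} = 1 by decide,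
    show Fintype.card (Multiplicative (ZMod 5)) = 5 by decide] at h5
  simp only [one_pow, one_mul, ← pow_add] at h2 h3 h5
  have h2 := Nat.pow_right_injective (a := 2) le_rfl h2
  have h3 := Nat.pow_right_injective (a := 3) (by norm_num) h3
  have h5 := Nat.pow_right_injective (a := 5) (by norm_num) h5
  omega

theorem isomorphismTypeIs_of_mulEquiv {G : Type*} [Group G] {l₂ l₃ r₀ : ℕ} {r : ℚ}
    (e : G ≃* FreeProductModel l₂ l₃ r₀) (hr : (r₀ : ℚ) = r) : IsomorphismTypeIs G l₂ l₃ r := by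
  refine ⟨r₀, hr, fun l₂' l₃' r' => ⟨?_, ?_⟩⟩
  · rintro ⟨e'⟩
    exact freeProductModel_unique (e'.symm.trans e)
  · rintro ⟨rfl, rfl, rfl⟩
    exact ⟨e⟩

theorem IsFreeGroup.eq_one_of_pow_eq_one {G : Type*} [Group G] [IsFreeGroup G] {n : ℕ} (hn : n ≠ 0)
    {x : G} (hx : x ^ n = 1) : x = 1 := by
  refine (IsFreeGroup.toFreeGroup G).injective (IsMulTorsionFree.pow_left_injective hn ?_)
  change (IsFreeGroup.toFreeGroup G) x ^ n = (IsFreeGroup.toFreeGroup G) 1 ^ n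
  rw [← map_pow, hx, map_one, one_pow]

/-- Free groups are torsion-free, whereas the generator of a cyclic factor is a nontrivial torsion
element. -/
theorem freeProductModel_not_free {G : Type*} [Group G] {l₂ l₃ r : ℕ}
    (e : G ≃* FreeProductModel l₂ l₃ r) (h : IsFreeGroup G) : l₂ = 0 ∧ l₃ = 0 := by
  have key : ∀ n : ℕ, n ≠ 0 → ∀ y : FreeProductModel l₂ l₃ r, y ^ n = 1 → y = 1 := by
    intro n hn y hy
    have := IsFreeGroup.eq_one_of_pow_eq_one hn (x := e.symm y) (by rw [← map_pow, hy, map_one])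
    simpa using this
  constructor
  · by_contra h0
    let i : Fin l₂ := ⟨0, Nat.pos_of_ne_zero h0⟩
    have h1 := key 2 (by norm_num) (Coprod.inl (CoprodI.of (i := i) (Multiplicative.ofAdd 1)))
      (by rw [← map_pow, ← map_pow, ← ofAdd_nsmul]; simp [show (2 : ZMod 2) = 0 from rfl])
    -- Killing the other factors and folding all copies of ℤ/2 onto one sends this element to the
    -- generator, so it is not 1.
    have h2 := congrArg (Coprod.lift
      (CoprodI.lift fun _ : Fin l₂ => MonoidHom.id (Multiplicative (ZMod 2))) 1) h1
    simp at h2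
  · by_contra h0
    let i : Fin l₃ := ⟨0, Nat.pos_of_ne_zero h0⟩
    have h1 := key 3 (by norm_num)
      (Coprod.inr (Coprod.inl (CoprodI.of (i := i) (Multiplicative.ofAdd 1))))
      (by rw [← map_pow, ← map_pow, ← map_pow, ← ofAdd_nsmul]; simp [show (3 : ZMod 3) = 0 from rfl])
    have h2 := congrArg (Coprod.lift 1 (Coprod.lift
      (CoprodI.lift fun _ : Fin l₃ => MonoidHom.id (Multiplicative (ZMod 3))) 1)) h1
    simp at h2

/-- Without torsion factors the model is a free group. -/
def freeProductModelFreeEquiv (r : ℕ) : FreeProductModel 0 0 r ≃* FreeGroup (Fin r) :=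
  MonoidHom.toMulEquiv (Coprod.lift 1 (Coprod.lift 1 (MonoidHom.id _)))
    (Coprod.inr.comp Coprod.inr)
    (by
      refine Coprod.hom_ext (CoprodI.ext_hom _ _ fun i => i.elim0)
        (Coprod.hom_ext (CoprodI.ext_hom _ _ fun i => i.elim0) ?_)
      ext; simp)
    (by ext; simp)

theorem isFreeOfRank_of_mulEquiv {G : Type*} [Group G] {r₀ : ℕ} {r : ℚ}
    (e : G ≃* FreeProductModel 0 0 r₀) (hr : (r₀ : ℚ) = r) : IsFreeOfRank G r :=
  ⟨r₀, hr, ⟨⟨e.trans (freeProductModelFreeEquiv r₀)⟩⟩⟩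

theorem isFreeGroup_iff {G : Type*} [Group G] {l₂ l₃ r : ℕ}
    (e : G ≃* FreeProductModel l₂ l₃ r) : IsFreeGroup G ↔ l₂ = 0 ∧ l₃ = 0 := by
  refine ⟨freeProductModel_not_free e, ?_⟩
  rintro ⟨rfl, rfl⟩
  exact IsFreeGroup.ofMulEquiv (e.trans (freeProductModelFreeEquiv r)).symm

end ModularSubgroups

/-! ### Right translation of cosets, and geodesic words. -/

namespace ModularSubgroups

open LabeledGraph

section CosetAction

variable {H : Subgroup PSL2Z}

/-- Right translation of cosets. -/
def cosetMul (x : Cosets H) (g : PSL2Z) : Cosets H :=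
  Quotient.map' (· * g) (fun p q h => by
    rw [QuotientGroup.rightRel_apply] at h ⊢
    simpa [mul_assoc] using h) x

infixl:70 " ◃ " => cosetMul

theorem coset_cosetMul (g h : PSL2Z) : coset H g ◃ h = coset H (g * h) := rfl

theorem base_cosetMul (g : PSL2Z) : base H ◃ g = coset H g := by
  rw [base, coset_cosetMul, one_mul]

theorem coset_surjective (x : Cosets H) : ∃ g, coset H g = x := Quotient.exists_rep x

@[simp]
theorem cosetMul_one (x : Cosets H) : x ◃ 1 = x := by
  obtain ⟨g, rfl⟩ := coset_surjective x
  rw [coset_cosetMul, mul_one]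

theorem cosetMul_mul (x : Cosets H) (g h : PSL2Z) : x ◃ (g * h) = x ◃ g ◃ h := by
  obtain ⟨k, rfl⟩ := coset_surjective x
  simp only [coset_cosetMul, mul_assoc]

@[simp]
theorem cosetMul_cosetMul_inv (x : Cosets H) (g : PSL2Z) : x ◃ g ◃ g⁻¹ = x := by
  rw [← cosetMul_mul, mul_inv_cancel, cosetMul_one]

@[simp]
theorem cosetMul_inv_cosetMul (x : Cosets H) (g : PSL2Z) : x ◃ g⁻¹ ◃ g = x := by
  rw [← cosetMul_mul, inv_mul_cancel, cosetMul_one]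

theorem cosetMul_eq_iff {x y : Cosets H} {g : PSL2Z} : x ◃ g = y ↔ x = y ◃ g⁻¹ :=
  ⟨fun h => by rw [← h, cosetMul_cosetMul_inv], fun h => by rw [h, cosetMul_inv_cosetMul]⟩

theorem cosetMul_left_injective (g : PSL2Z) : Function.Injective fun x : Cosets H => x ◃ g :=
  fun x y h => by simpa using congrArg (· ◃ g⁻¹) h

theorem base_cosetMul_eq_base {g : PSL2Z} : base H ◃ g = base H ↔ g ∈ H := by
  rw [base_cosetMul, base, eq_comm, coset, coset, Quotient.eq, QuotientGroup.rightRel_apply]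
  simp

end CosetAction

theorem letterValue_true (c : Letter) : letterValue (c, true) = gen c := rfl

theorem letterValue_false (c : Letter) : letterValue (c, false) = (gen c)⁻¹ := rfl

theorem letterValue_not (c : Letter) (e : Bool) :
    letterValue (c, !e) = (letterValue (c, e))⁻¹ := by
  cases e <;> simp [letterValue]

@[simp]
theorem wordValue_nil : wordValue [] = 1 := rfl

@[simp]
theorem wordValue_append (u v : Word) : wordValue (u ++ v) = wordValue u * wordValue v := by
  simp [wordValue]

@[simp]
theorem wordValue_cons (x : Letter × Bool) (v : Word) :
    wordValue (x :: v) = letterValue x * wordValue v := by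
  simp [wordValue]

theorem wordValue_invRev (w : Word) : wordValue (FreeGroup.invRev w) = (wordValue w)⁻¹ := by
  induction w with
  | nil => simp
  | cons x w ih =>
    rw [FreeGroup.invRev_cons, wordValue_append, ih, wordValue_cons, mul_inv_rev]
    simp [FreeGroup.invRev, letterValue_not]

theorem exists_word (g : PSL2Z) : ∃ w, wordValue w = g := by
  have hg : g ∈ Subgroup.closure (Set.range gen) := by rw [closure_gen]; trivial
  induction hg using Subgroup.closure_induction with
  | mem x hx =>
    obtain ⟨c, rfl⟩ := hx
    exact ⟨[(c, true)], by simp [letterValue_true]⟩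
  | one => exact ⟨[], rfl⟩
  | mul x y _ _ hx hy =>
    obtain ⟨u, rfl⟩ := hx
    obtain ⟨v, rfl⟩ := hy
    exact ⟨u ++ v, wordValue_append u v⟩
  | inv x _ hx =>
    obtain ⟨u, rfl⟩ := hx
    exact ⟨FreeGroup.invRev u, wordValue_invRev u⟩

theorem gen_a_mul_self : gen Letter.a * gen Letter.a = 1 := by rw [← pow_two, gen_a_sq]

theorem gen_a_inv : (gen Letter.a)⁻¹ = gen Letter.a := inv_eq_of_mul_eq_one_right gen_a_mul_self

theorem gen_b_mul_self : gen Letter.b * gen Letter.b = (gen Letter.b)⁻¹ := by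
  rw [eq_inv_iff_mul_eq_one, ← pow_two, ← pow_succ, gen_b_cube]

theorem gen_b_inv_mul_self : (gen Letter.b)⁻¹ * (gen Letter.b)⁻¹ = gen Letter.b := by
  rw [← mul_inv_rev, gen_b_mul_self, inv_inv]

/-- In a cyclic group of order 2 or 3 every element is 1, the generator or its inverse. -/
theorem exists_short_word (c : Letter) (e e' : Bool) :
    ∃ z : Word, z.length ≤ 1 ∧ wordValue z = letterValue (c, e) * letterValue (c, e') := by
  rcases c with _ | _ <;> rcases e with _ | _ <;> rcases e' with _ | _
  · exact ⟨[], by simp, by simp [letterValue, gen_a_inv, gen_a_mul_self]⟩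
  · exact ⟨[], by simp, by simp [letterValue]⟩
  · exact ⟨[], by simp, by simp [letterValue]⟩
  · exact ⟨[], by simp, by simp [letterValue, gen_a_mul_self]⟩
  · exact ⟨[(Letter.b, true)], by simp, by simp [letterValue, gen_b_inv_mul_self]⟩
  · exact ⟨[], by simp, by simp [letterValue]⟩
  · exact ⟨[], by simp, by simp [letterValue]⟩
  · exact ⟨[(Letter.b, false)], by simp, by simp [letterValue, gen_b_mul_self]⟩

theorem IsGeodesic.isAlternating {w : Word} (hw : IsGeodesic w) : IsAlternating w := by
  rw [IsAlternating, List.isChain_iff_forall_rel_of_append_cons_cons]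
  rintro ⟨c, e⟩ ⟨c', e'⟩ u v rfl (rfl : c = c')
  obtain ⟨z, hz, hval⟩ := exists_short_word c e e'
  have := hw (u ++ (z ++ v)) (by simp [hval, mul_assoc])
  simp at this
  omega

/-- A shortest word with the same value is alternating as well, hence of the same length. -/
theorem IsAlternating.isGeodesic {w : Word} (hw : IsAlternating w) : IsGeodesic w := by
  classical
  have hex : ∃ k, ∃ v : Word, v.length = k ∧ wordValue v = wordValue w := ⟨_, w, rfl, rfl⟩
  obtain ⟨v, hv, hval⟩ := Nat.find_spec hex
  have hmin : ∀ w' : Word, wordValue w' = wordValue w → v.length ≤ w'.length := fun w' h =>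
    hv ▸ Nat.find_min' hex ⟨w', rfl, h⟩
  have hgeo : IsGeodesic v := fun w' h => hmin w' (h.trans hval)
  rw [IsGeodesic, hw.length_eq hgeo.isAlternating hval.symm]
  exact hmin

theorem IsAlternating.invRev {w : Word} (hw : IsAlternating w) :
    IsAlternating (FreeGroup.invRev w) := by
  rw [IsAlternating, FreeGroup.invRev, List.isChain_reverse, List.isChain_map]
  exact List.IsChain.imp (fun _ _ h => h.symm) hw

/-! ### The Stallings graph in terms of reachability. -/

section Reach

variable {H : Subgroup PSL2Z}

/-- The coset `p` is reached from the base by an alternating word not ending in `c` or `c⁻¹`. -/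
def Reach (c : Letter) (p : Cosets H) : Prop :=
  ∃ u : Word, IsAlternating u ∧ (∀ x ∈ u.getLast?, x.1 ≠ c) ∧ base H ◃ wordValue u = p

theorem reach_base (c : Letter) : Reach c (base H) := ⟨[], List.isChain_nil, by simp, by simp⟩

theorem Reach.step {c c' : Letter} {p : Cosets H} (hp : Reach c p) (hc : c ≠ c') (e : Bool) :
    Reach c' (p ◃ letterValue (c, e)) := by
  obtain ⟨u, hu, hlast, rfl⟩ := hp
  refine ⟨u ++ [(c, e)], ?_, by simp [hc], by simp [cosetMul_mul]⟩
  rw [IsAlternating, List.isChain_append]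
  exact ⟨hu, List.isChain_singleton _, by simpa using hlast⟩

/-- A path to the base, reversed, is a path from the base. -/
theorem Reach.of_invRev {c : Letter} {q : Cosets H} {v : Word} (hv : IsAlternating v)
    (hhead : ∀ x ∈ v.head?, x.1 ≠ c) (hq : base H = q ◃ wordValue v) : Reach c q := by
  refine ⟨FreeGroup.invRev v, hv.invRev, ?_, ?_⟩
  · intro x hx
    simp only [FreeGroup.invRev, List.getLast?_reverse, List.head?_map, Option.mem_def,
      Option.map_eq_some_iff] at hx
    obtain ⟨z, hz, rfl⟩ := hx
    exact hhead z hz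
  · rw [wordValue_invRev, hq, cosetMul_cosetMul_inv]

theorem schreier_edge {c : Letter} {p q : Cosets H} :
    (schreierGraph H).edge c p q ↔ q = p ◃ gen c := by
  constructor
  · rintro ⟨g, rfl, rfl⟩
    rfl
  · rintro rfl
    obtain ⟨g, rfl⟩ := coset_surjective p
    exact ⟨g, rfl, rfl⟩

theorem schreier_step {x : Letter × Bool} {p q : Cosets H} :
    (schreierGraph H).Step x p q ↔ q = p ◃ letterValue x := by
  rcases x with ⟨c, _ | _⟩
  · simp only [Step, schreier_edge, letterValue_false]
    rw [← cosetMul_eq_iff]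
    simp [eq_comm]
  · simp [Step, schreier_edge, letterValue_true]

theorem schreier_isPath {p q : Cosets H} {w : Word} :
    (schreierGraph H).IsPath p w q ↔ q = p ◃ wordValue w := by
  constructor
  · intro h
    induction h with
    | nil _ => simp
    | snoc _ hs ih => rw [schreier_step.1 hs, ih]; simp [cosetMul_mul]
  · rintro rfl
    induction w generalizing p with
    | nil => simpa using IsPath.nil (by simp [schreierGraph])
    | cons x w ih =>
      rw [wordValue_cons, cosetMul_mul]
      exact IsPath.cons (by simp [schreierGraph]) (schreier_step.2 rfl) ih

theorem isAlternating_loop {c : Letter} {u v : Word} (e : Bool) (hu : IsAlternating u)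
    (hu' : ∀ x ∈ u.getLast?, x.1 ≠ c) (hv : IsAlternating v) (hv' : ∀ x ∈ v.getLast?, x.1 ≠ c) :
    IsAlternating (u ++ (c, e) :: FreeGroup.invRev v) := by
  rw [IsAlternating, List.isChain_append, List.isChain_cons]
  refine ⟨hu, ⟨?_, hv.invRev⟩, by simpa using hu'⟩
  intro x hx
  simp only [FreeGroup.invRev, List.head?_reverse, List.getLast?_map, Option.mem_def,
    Option.map_eq_some_iff] at hx
  obtain ⟨z, hz, rfl⟩ := hx
  exact (hv' z hz).symm

theorem IsAlternating.parts {c : Letter} {e : Bool} {u v : Word}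
    (h : IsAlternating (u ++ (c, e) :: v)) :
    IsAlternating u ∧ (∀ x ∈ u.getLast?, x.1 ≠ c) ∧ IsAlternating v ∧
      ∀ x ∈ v.head?, x.1 ≠ c := by
  rw [IsAlternating, List.isChain_append, List.isChain_cons] at h
  exact ⟨h.1, by simpa using h.2.2, h.2.1.2, by simpa [eq_comm] using h.2.1.1⟩

/-- Cutting an alternating loop at a c-edge leaves two alternating words, neither having c^{±1} next
to the cut. Conversely, two words witnessing `Reach c` at the ends, the second one inverted, glue
along the c-edge to an alternating loop. -/
theorem stallings_edge {c : Letter} {p q : Cosets H} :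
    (stallingsGraph H).edge c p q ↔ q = p ◃ gen c ∧ Reach c p ∧ Reach c q := by
  constructor
  · rintro ⟨he, u, v, ⟨hg, hu, hv⟩ | ⟨hg, hu, hv⟩⟩
    · rw [schreier_isPath] at hu hv
      obtain ⟨h1, h2, h3, h4⟩ := hg.isAlternating.parts
      exact ⟨schreier_edge.1 he, ⟨u, h1, h2, hu.symm⟩, .of_invRev h3 h4 hv⟩
    · rw [schreier_isPath] at hu hv
      obtain ⟨h1, h2, h3, h4⟩ := hg.isAlternating.parts
      exact ⟨schreier_edge.1 he, .of_invRev h3 h4 hv, ⟨u, h1, h2, hu.symm⟩⟩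
  · rintro ⟨rfl, ⟨u, hu, hu', hp⟩, ⟨v, hv, hv', hq⟩⟩
    refine ⟨schreier_edge.2 rfl, u, FreeGroup.invRev v, .inl ⟨?_, ?_, ?_⟩⟩
    · exact (isAlternating_loop true hu hu' hv hv').isGeodesic
    · exact schreier_isPath.2 hp.symm
    · rw [schreier_isPath, ← hq, wordValue_invRev, cosetMul_cosetMul_inv]

/-- Where an alternating loop u v is cut, u does not end in c^{±1} or v does not begin with it, so u
or the inverse of v witnesses `Reach c`. Conversely, a word not ending in a^{±1} followed by the
inverse of one not ending in b^{±1} is alternating. -/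
theorem stallings_verts {p : Cosets H} :
    p ∈ (stallingsGraph H).verts ↔ ∀ c, Reach c p := by
  constructor
  · rintro ⟨u, v, hg, hu, hv⟩ c
    rw [schreier_isPath] at hu hv
    have h := hg.isAlternating
    rw [IsAlternating, List.isChain_append] at h
    by_cases hlast : ∀ x ∈ u.getLast?, x.1 ≠ c
    · exact ⟨u, h.1, hlast, hu.symm⟩
    · push Not at hlast
      obtain ⟨x, hx, rfl⟩ := hlast
      exact .of_invRev h.2.1 (fun y hy => (h.2.2 x hx y hy).symm) hv
  · intro h
    obtain ⟨u, hu, hu', hp⟩ := h Letter.a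
    obtain ⟨v, hv, hv', hq⟩ := h Letter.b
    refine ⟨u, FreeGroup.invRev v, ?_, schreier_isPath.2 hp.symm, ?_⟩
    · refine IsAlternating.isGeodesic (List.isChain_append.2 ⟨hu, hv.invRev, ?_⟩)
      intro x hx y hy hxy
      simp only [FreeGroup.invRev, List.head?_reverse, List.getLast?_map, Option.mem_def,
        Option.map_eq_some_iff] at hy
      obtain ⟨z, hz, rfl⟩ := hy
      have h1 := hu' x hx
      have h2 := hv' z hz
      rcases x with ⟨_ | _, _⟩ <;> rcases z with ⟨_ | _, _⟩ <;> simp_all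
    · rw [schreier_isPath, ← hq, wordValue_invRev, cosetMul_cosetMul_inv]

/-- The distance of a coset from the base. -/
noncomputable def dist (p : Cosets H) : ℕ :=
  sInf {k | ∃ w : Word, w.length = k ∧ base H ◃ wordValue w = p}

theorem dist_le (w : Word) : dist (base H ◃ wordValue w) ≤ w.length := Nat.sInf_le ⟨w, rfl, rfl⟩

theorem exists_dist_eq (p : Cosets H) :
    ∃ w : Word, IsAlternating w ∧ w.length = dist p ∧ base H ◃ wordValue w = p := by
  have hne : {k | ∃ w : Word, w.length = k ∧ base H ◃ wordValue w = p}.Nonempty := by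
    obtain ⟨g, rfl⟩ := coset_surjective p
    obtain ⟨w, rfl⟩ := exists_word g
    exact ⟨_, w, rfl, base_cosetMul _⟩
  obtain ⟨w, hw, hp⟩ := Nat.sInf_mem hne
  refine ⟨w, IsGeodesic.isAlternating fun w' h => ?_, hw, hp⟩
  rw [hw]
  exact Nat.sInf_le ⟨w', rfl, by rw [h, hp]⟩

theorem dist_base : dist (base H) = 0 := by
  simpa using dist_le (H := H) []

theorem dist_pos {p : Cosets H} (hp : p ≠ base H) : 0 < dist p := by
  obtain ⟨w, _, hw, rfl⟩ := exists_dist_eq p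
  rw [← hw, List.length_pos_iff]
  rintro rfl
  simp at hp

/-- Every vertex but the base has a predecessor on a shortest path. -/
theorem exists_pred {p : Cosets H} (hp : p ≠ base H) :
    ∃ c e q, Reach c q ∧ q ◃ letterValue (c, e) = p ∧ dist q < dist p := by
  obtain ⟨w, hw, hlen, rfl⟩ := exists_dist_eq p
  rcases List.eq_nil_or_concat' w with rfl | ⟨u, ⟨c, e⟩, rfl⟩
  · simp at hp
  · obtain ⟨h1, h2, -⟩ := hw.parts
    refine ⟨c, e, base H ◃ wordValue u, ⟨u, h1, h2, rfl⟩, by simp [cosetMul_mul], ?_⟩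
    have := dist_le (H := H) u
    rw [← hlen, List.length_append, List.length_singleton]
    omega

/-- A shortest word to p must end in c^{±1}; undoing that letter moves nearer to the base. -/
theorem exists_lt_of_not_reach {c : Letter} {p : Cosets H} (hp : ¬ Reach c p) :
    ∃ e, dist (p ◃ letterValue (c, e)) < dist p := by
  have hb : p ≠ base H := by
    rintro rfl
    exact hp (reach_base c)
  obtain ⟨c', e, q, hq, rfl, hlt⟩ := exists_pred hb
  by_cases hc : c' = c
  · subst hc
    exact ⟨!e, by simpa [letterValue_not] using hlt⟩
  · exact (hp (hq.step hc e)).elim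

end Reach

end ModularSubgroups

/-! ### Actions of the modular group defined by cocycles. -/

namespace ModularSubgroups

open Monoid

variable {H : Subgroup PSL2Z}

theorem gen_induction {motive : PSL2Z → Prop} (g : PSL2Z) (gen : ∀ c, motive (gen c))
    (one : motive 1) (mul : ∀ g h, motive g → motive h → motive (g * h))
    (inv : ∀ g, motive g → motive g⁻¹) : motive g := by
  have hg : g ∈ Subgroup.closure (Set.range ModularSubgroups.gen) := by rw [closure_gen]; trivial
  induction hg using Subgroup.closure_induction with
  | mem x hx =>
    obtain ⟨c, rfl⟩ := hx
    exact gen c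
  | one => exact one
  | mul x y _ _ hx hy => exact mul x y hx hy
  | inv x _ hx => exact inv x hx

/-- An action of the modular group on `M × Cosets H` given by a cocycle: crossing the `c`-edge
at `x` multiplies the first component by `σ c x * ε c x * (σ c (x ◃ gen c))⁻¹`. -/
theorem exists_cocycle_action {M : Type} [Group M] (σ ε : Letter → Cosets H → M)
    (hε : ∀ c x, ε c x ^ letterOrder c = 1) (hε' : ∀ c x, x ◃ gen c ≠ x → ε c x = 1) :
    ∃ act : PSL2Z → M × Cosets H → M × Cosets H, (∀ y, act 1 y = y) ∧
      (∀ g h y, act (g * h) y = act h (act g y)) ∧ (∀ g y, (act g y).2 = y.2 ◃ g) ∧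
      ∀ c m x, act (gen c) (m, x) =
        (m * σ c x * ε c x * (σ c (x ◃ gen c))⁻¹, x ◃ gen c) := by
  let D (c : Letter) : Equiv.Perm (M × Cosets H) :=
    { toFun := fun y => (y.1 * ε c y.2, y.2 ◃ gen c)
      invFun := fun y => (y.1 * (ε c (y.2 ◃ (gen c)⁻¹))⁻¹, y.2 ◃ (gen c)⁻¹)
      left_inv := fun y => by simp
      right_inv := fun y => by simp }
  let τ (c : Letter) : Equiv.Perm (M × Cosets H) :=
    { toFun := fun y => (y.1 * σ c y.2, y.2)
      invFun := fun y => (y.1 * (σ c y.2)⁻¹, y.2)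
      left_inv := fun y => by simp
      right_inv := fun y => by simp }
  -- The twist ε lives at fixed points only, so it is constant along each orbit and `D c ^ k`
  -- accumulates `ε ^ k`.
  have hstep : ∀ c x, ε c (x ◃ gen c) = ε c x := by
    intro c x
    by_cases h : x ◃ gen c = x
    · rw [h]
    · rw [hε' c x h, hε' c (x ◃ gen c) fun h' => h (cosetMul_left_injective _ h')]
  have hpow : ∀ c x (k : ℕ), ε c (x ◃ gen c ^ k) = ε c x := by
    intro c x k
    induction k with
    | zero => simp
    | succ k ih => rw [pow_succ, cosetMul_mul, hstep, ih]
  have hD : ∀ c (k : ℕ) y, (D c ^ k) y = (y.1 * ε c y.2 ^ k, y.2 ◃ gen c ^ k) := by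
    intro c k y
    induction k with
    | zero => simp
    | succ k ih =>
      rw [pow_succ', Equiv.Perm.mul_apply, ih]
      simp only [D, Equiv.coe_fn_mk, hpow, mul_assoc, ← pow_succ, ← cosetMul_mul]
  have hD1 : ∀ c, D c ^ letterOrder c = 1 := by
    intro c
    ext1 y
    rw [hD, hε, gen_pow_letterOrder]
    simp
  -- A right action is a homomorphism to the opposite of the permutation group. Conjugation by `τ c`
  -- keeps the order relation of `D c` and inserts the factors σ.
  obtain ⟨ρ, hρ⟩ := exists_hom (P := (Equiv.Perm (M × Cosets H))ᵐᵒᵖ)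
    (fun c => MulOpposite.op ((τ c)⁻¹ * D c * τ c)) (fun c => by
      rw [← MulOpposite.op_pow, MulOpposite.op_eq_one_iff]
      have := conj_pow (a := (τ c)⁻¹) (b := D c) (i := letterOrder c)
      rw [inv_inv] at this
      rw [this, hD1, mul_one, inv_mul_cancel])
  have hmul : ∀ g h y, (ρ (g * h)).unop y = (ρ h).unop ((ρ g).unop y) := by
    intro g h y
    rw [map_mul, MulOpposite.unop_mul, Equiv.Perm.mul_apply]
  have hone : ∀ y, (ρ 1).unop y = y := by simp
  have hgen : ∀ c m x, (ρ (gen c)).unop (m, x) =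
        (m * σ c x * ε c x * (σ c (x ◃ gen c))⁻¹, x ◃ gen c) := by
    intro c m x
    rw [hρ]
    rfl
  refine ⟨fun g => (ρ g).unop, hone, hmul, fun g => ?_, hgen⟩
  refine gen_induction (motive := fun g => ∀ y, ((ρ g).unop y).2 = y.2 ◃ g) g ?_ ?_ ?_ ?_
  · rintro c ⟨m, x⟩
    rw [hgen]
  · simp
  · intro g h hg hh y
    rw [hmul, hh, hg, cosetMul_mul]
  · intro g hg y
    have := hg ((ρ g⁻¹).unop y)
    rw [← hmul, inv_mul_cancel, hone] at this
    rw [this, cosetMul_cosetMul_inv]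

/-! ### Roots of the orbits and the transversal that follows them. -/

/-- The orbit of a coset under right translation by a generator. -/
def genOrbit (c : Letter) (x : Cosets H) : Set (Cosets H) := Set.range fun k : ℤ => x ◃ gen c ^ k

theorem mem_genOrbit_self (c : Letter) (x : Cosets H) : x ∈ genOrbit c x := ⟨0, by simp⟩

theorem genOrbit_cosetMul (c : Letter) (x : Cosets H) : genOrbit c (x ◃ gen c) = genOrbit c x := by
  ext y
  constructor
  · rintro ⟨k, rfl⟩
    exact ⟨1 + k, by simp only [zpow_one_add, cosetMul_mul]⟩
  · rintro ⟨k, rfl⟩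
    exact ⟨-1 + k, by simp only [← cosetMul_mul]; group⟩

theorem mem_genOrbit_iff {c : Letter} {x y : Cosets H} :
    y ∈ genOrbit c x ↔ y = x ∨ y = x ◃ gen c ∨ y = x ◃ (gen c)⁻¹ := by
  constructor
  · rintro ⟨k, rfl⟩
    cases c with
    | a =>
      have hk := zpow_eq_zpow_emod' k gen_a_sq
      have h2 : k % 2 = 0 ∨ k % 2 = 1 := by omega
      push_cast at hk
      rcases h2 with h | h <;> rw [h] at hk <;> simp [hk]
    | b =>
      have hk := zpow_eq_zpow_emod' k gen_b_cube
      have h3 : k % 3 = 0 ∨ k % 3 = 1 ∨ k % 3 = 2 := by omega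
      push_cast at hk
      rcases h3 with h | h | h <;> rw [h] at hk
      · simp [hk]
      · simp [hk]
      · rw [zpow_two, gen_b_mul_self] at hk
        simp [hk]
  · rintro (rfl | rfl | rfl)
    · exact mem_genOrbit_self _ _
    · exact ⟨1, by simp⟩
    · exact ⟨-1, by simp⟩

/-- The chosen vertex nearest to the base in the orbit of a coset. -/
noncomputable def root (c : Letter) (x : Cosets H) : Cosets H :=
  Function.argminOn dist (genOrbit c x) ⟨x, mem_genOrbit_self c x⟩

theorem root_mem (c : Letter) (x : Cosets H) : root c x ∈ genOrbit c x :=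
  Function.argminOn_mem _ _ _

theorem dist_root_le {c : Letter} {x y : Cosets H} (hy : y ∈ genOrbit c x) :
    dist (root c x) ≤ dist y :=
  Function.argminOn_le dist (genOrbit c x) hy

-- The root is chosen from the orbit as a set, so it is the same for all members of the orbit.
@[simp]
theorem root_cosetMul (c : Letter) (x : Cosets H) : root c (x ◃ gen c) = root c x := by
  simp only [root, genOrbit_cosetMul]

@[simp]
theorem root_cosetMul_inv (c : Letter) (x : Cosets H) : root c (x ◃ (gen c)⁻¹) = root c x := by
  rw [← root_cosetMul, cosetMul_inv_cosetMul]

@[simp]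
theorem root_root (c : Letter) (x : Cosets H) : root c (root c x) = root c x := by
  rcases mem_genOrbit_iff.1 (root_mem c x) with h | h | h
  · rw [h, h]
  · rw [h, root_cosetMul, h]
  · rw [h, root_cosetMul_inv, h]

@[simp]
theorem root_base (c : Letter) : root c (base H) = base H := by
  by_contra h
  have h1 := dist_pos h
  have h2 := dist_root_le (mem_genOrbit_self c (base H))
  rw [dist_base] at h2
  omega

theorem letterValue_mem_genOrbit (c : Letter) (e : Bool) (x : Cosets H) :
    x ◃ letterValue (c, e) ∈ genOrbit c x := by
  rw [mem_genOrbit_iff]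
  cases e
  · simp [letterValue_false]
  · simp [letterValue_true]

theorem root_ne_of_dist_lt {c : Letter} {e : Bool} {x : Cosets H}
    (h : dist (x ◃ letterValue (c, e)) < dist x) : dist (root c x) < dist x ∧ root c x ≠ x := by
  have h1 := (dist_root_le (letterValue_mem_genOrbit c e x)).trans_lt h
  refine ⟨h1, fun h2 => ?_⟩
  rw [h2] at h1
  exact lt_irrefl _ h1

/-- The last letter of a shortest word to x tells in which of its two orbits x is not nearest to the
base. This makes descent along roots terminate at the base. -/
theorem exists_root_lt {x : Cosets H} (hx : x ≠ base H) :
    ∃ c, dist (root c x) < dist x ∧ root c x ≠ x := by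
  obtain ⟨c, e, q, -, rfl, hlt⟩ := exists_pred hx
  exact ⟨c, root_ne_of_dist_lt (e := !e) (by simpa [letterValue_not] using hlt)⟩

theorem eq_base_of_root_eq {x : Cosets H} (h : ∀ c, root c x = x) : x = base H := by
  by_contra hx
  obtain ⟨c, -, hc⟩ := exists_root_lt hx
  exact hc (h c)

open Classical in
/-- The element leading from `root c x` to `x`. -/
noncomputable def gap (c : Letter) (x : Cosets H) : PSL2Z :=
  if root c x = x then 1 else if root c x ◃ gen c = x then gen c else (gen c)⁻¹

theorem gap_of_root_eq {c : Letter} {x : Cosets H} (h : root c x = x) : gap c x = 1 := if_pos h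

theorem gap_cases (c : Letter) (x : Cosets H) :
    (root c x = x ∧ gap c x = 1) ∨
    (root c x ≠ x ∧ root c x ◃ gen c = x ∧ gap c x = gen c) ∨
    (root c x ≠ x ∧ root c x ◃ gen c ≠ x ∧ root c x ◃ (gen c)⁻¹ = x ∧ gap c x = (gen c)⁻¹) := by
  by_cases h1 : root c x = x
  · exact .inl ⟨h1, if_pos h1⟩
  · by_cases h2 : root c x ◃ gen c = x
    · exact .inr (.inl ⟨h1, h2, by rw [gap, if_neg h1, if_pos h2]⟩)
    · refine .inr (.inr ⟨h1, h2, ?_, by rw [gap, if_neg h1, if_neg h2]⟩)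
      rcases mem_genOrbit_iff.1 (root_mem c x) with h | h | h
      · exact (h1 h).elim
      · rw [h, cosetMul_cosetMul_inv]
      · exact (h2 (by rw [h, cosetMul_inv_cosetMul])).elim

/-- In an orbit without fixed points the exponents of c relative to the root add modulo the order.
At a fixed point this fails, both gaps being 1; the failure is the source of the torsion factors. -/
theorem gap_cosetMul {c : Letter} {x : Cosets H} (hx : x ◃ gen c ≠ x) :
    gap c (x ◃ gen c) = gap c x * gen c := by
  rcases gap_cases c x with ⟨h1, h2⟩ | ⟨h1, h2, h3⟩ | ⟨h1, h2, h3, h4⟩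
  · rw [h2, one_mul, gap, root_cosetMul, h1, if_neg hx.symm, if_pos rfl]
  · rw [h3, gap, root_cosetMul]
    cases c with
    | a =>
      rw [gen_a_mul_self, if_pos]
      conv_rhs => rw [← h2, ← cosetMul_mul, gen_a_mul_self, cosetMul_one]
    | b =>
      rw [gen_b_mul_self, if_neg, if_neg]
      · rw [h2]
        exact hx.symm
      · intro h
        rw [h, ← cosetMul_mul, gen_b_mul_self, cosetMul_eq_iff, inv_inv] at h2
        exact hx h2.symm
  · rw [h4, inv_mul_cancel]
    refine gap_of_root_eq ?_
    rw [root_cosetMul, ← h3, cosetMul_inv_cosetMul, h3]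

open Classical in
/-- A transversal following the tree of the roots. -/
noncomputable def trans (x : Cosets H) : PSL2Z :=
  if _hx : x = base H then 1
  else if _ha : root Letter.a x = x then trans (root Letter.b x) * gap Letter.b x
  else trans (root Letter.a x) * gap Letter.a x
-- Roots may tie in distance with x, so an a-step may lower the indicator bit alone. A b-step is
-- made at an a-root other than the base: there the distance drops, which outweighs a rise of the
-- bit.
termination_by 2 * dist x + if root Letter.a x = x then 0 else 1
decreasing_by
  · obtain ⟨_ | _, hc, hc'⟩ := exists_root_lt _hx
    · exact (hc' _ha).elim
    · rw [if_pos _ha]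
      split_ifs <;> omega
  · have := dist_root_le (mem_genOrbit_self Letter.a x)
    rw [if_pos (root_root _ _), if_neg _ha]
    omega

/-- The transversal adapted to the orbits of the generator `c`. -/
noncomputable def orbitTrans (c : Letter) (x : Cosets H) : PSL2Z := trans (root c x) * gap c x

theorem trans_base : trans (base H) = 1 := by rw [trans, dif_pos rfl]

/-- `trans` moves to the a-root whenever x is not one, so it already is adapted to the a-orbits. -/
theorem orbitTrans_a (x : Cosets H) : orbitTrans Letter.a x = trans x := by
  by_cases h : root Letter.a x = x
  · rw [orbitTrans, gap_of_root_eq h, h, mul_one]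
  · rw [trans, dif_neg, dif_neg h, orbitTrans]
    rintro rfl
    exact h (root_base _)

/-- At a root for one letter the descent has to use the other letter, so both adapted transversals
agree with `trans` there. Only cosets that are roots for neither letter can produce a discrepancy.
-/
theorem orbitTrans_of_root_eq {c c' : Letter} {x : Cosets H} (h : root c' x = x) :
    orbitTrans c x = trans x := by
  cases c with
  | a => exact orbitTrans_a x
  | b =>
    by_cases hb : root Letter.b x = x
    · rw [orbitTrans, gap_of_root_eq hb, hb, mul_one]
    · cases c' with
      | b => exact (hb h).elim
      | a =>
        rw [trans, dif_neg, dif_pos h, orbitTrans]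
        rintro rfl
        exact hb (root_base _)

theorem orbitTrans_cosetMul {c : Letter} {x : Cosets H} (hx : x ◃ gen c ≠ x) :
    orbitTrans c (x ◃ gen c) = orbitTrans c x * gen c := by
  rw [orbitTrans, root_cosetMul, gap_cosetMul hx, ← mul_assoc, orbitTrans]

/-- Induction along the recursion of `trans`; the side condition in `step` is the one under which
`orbitTrans c x` equals `trans x`. -/
theorem trans_induction {motive : Cosets H → Prop} (x : Cosets H) (base : motive (base H))
    (step : ∀ x c, (c = Letter.a ∨ ∃ c', root c' x = x) → motive (root c x) → motive x) :
    motive x := by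
  induction hk : 2 * dist x + (open Classical in if root Letter.a x = x then 0 else 1)
    using Nat.strong_induction_on generalizing x with | _ k ih
  subst hk
  by_cases hx : x = ModularSubgroups.base H
  · rwa [hx]
  by_cases ha : root Letter.a x = x
  · refine step x Letter.b (.inr ⟨_, ha⟩) (ih _ ?_ _ rfl)
    obtain ⟨_ | _, hc, hc'⟩ := exists_root_lt hx
    · exact (hc' ha).elim
    · rw [if_pos ha]
      split_ifs <;> omega
  · refine step x Letter.a (.inl rfl) (ih _ ?_ _ rfl)
    have := dist_root_le (mem_genOrbit_self Letter.a x)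
    rw [if_pos (root_root _ _), if_neg ha]
    omega

end ModularSubgroups

/-! ### The free product decomposition of H. -/

namespace ModularSubgroups

open Monoid

variable {H : Subgroup PSL2Z}

theorem orbitTrans_conj_pow (c : Letter) (x : Cosets H) :
    (orbitTrans c x * gen c * (orbitTrans c x)⁻¹) ^ letterOrder c = 1 := by
  rw [conj_pow, gen_pow_letterOrder, mul_one, mul_inv_cancel]

/-- A group with enough generators maps isomorphically onto `H`: `ψ` has the fixed points of the
generators and the cosets outside of the tree as free generators. -/
theorem nonempty_mulEquiv_of_generators {M : Type} [Group M] (ψ : M →* PSL2Z)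
    (σ ε : Letter → Cosets H → M) (hε : ∀ c x, ε c x ^ letterOrder c = 1)
    (hε' : ∀ c x, x ◃ gen c ≠ x → ε c x = 1) (hσ : ∀ x, σ Letter.a x = 1)
    (hσ' : ∀ c c' x, root c' x = x → σ c x = 1)
    (hψσ : ∀ c x, ψ (σ c x) = trans x * (orbitTrans c x)⁻¹)
    (hψε : ∀ c x, x ◃ gen c = x → ψ (ε c x) = orbitTrans c x * gen c * (orbitTrans c x)⁻¹)
    (hgen : ∀ N : Subgroup M, (∀ c x, ε c x ∈ N) → (∀ x, σ Letter.b x ∈ N) → N = ⊤) :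
    Nonempty (H ≃* M) := by
  obtain ⟨act, hone, hmul, hsnd, hact⟩ := exists_cocycle_action σ ε hε hε'
  have hinv : ∀ g y z, act g y = z → act g⁻¹ z = y := by
    rintro g y _ rfl
    rw [← hmul, mul_inv_cancel, hone]
  -- The walk from the root to y starts where σ is 1 and crosses no loop, so only the final `(σ c
  -- y)⁻¹` survives.
  have hgap : ∀ c y m, act (gap c y) (m, root c y) = (m * (σ c y)⁻¹, y) := by
    intro c y m
    have hr := hσ' c c (root c y) (root_root c y)
    rcases gap_cases c y with ⟨h1, h2⟩ | ⟨h1, h2, h3⟩ | ⟨h1, h2, h3, h4⟩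
    · rw [h2, hone, h1, hσ' c c y h1, inv_one, mul_one]
    · rw [h3, hact, hr, hε' c _ (by rw [h2]; exact h1.symm), h2, mul_one, mul_one]
    · rw [h4]
      refine hinv _ _ _ ?_
      have hy : y ◃ gen c = root c y := by rw [← h3, cosetMul_inv_cosetMul, h3]
      rw [hact, hε' c y (by rw [hy]; exact h1), hy, hr]
      simp
  -- Along the tree of roots σ is trivial as well, so the first coordinate never changes.
  have htrans : ∀ x m, act (trans x) (m, base H) = (m, x) := by
    intro x
    induction x using trans_induction with
    | base => intro m; rw [trans_base, hone]
    | step x c hc ih =>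
      intro m
      have h1 : orbitTrans c x = trans x := by
        rcases hc with rfl | ⟨c', hc'⟩
        · exact orbitTrans_a x
        · exact orbitTrans_of_root_eq hc'
      have h2 : σ c x = 1 := by
        rcases hc with rfl | ⟨c', hc'⟩
        · exact hσ x
        · exact hσ' c c' x hc'
      rw [← h1, orbitTrans, hmul, ih, hgap, h2, inv_one, mul_one]
  have horbit : ∀ c x m, act (orbitTrans c x) (m, base H) = (m * (σ c x)⁻¹, x) := by
    intro c x m
    rw [orbitTrans, hmul, htrans, hgap]
  -- The walk along `ψ w` returns to the base and records w. The elements w with this property form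
  -- a subgroup, so generators suffice.
  have hψ_act : ∀ w m, act (ψ w) (m, base H) = (m * w, base H) := by
    let N : Subgroup M :=
      { carrier := {w | ∀ m, act (ψ w) (m, base H) = (m * w, base H)}
        one_mem' := fun m => by rw [map_one, hone, mul_one]
        mul_mem' := fun {v w} hv hw m => by rw [map_mul, hmul, hv, hw, mul_assoc]
        inv_mem' := fun {w} hw m => by
          rw [map_inv]
          refine hinv _ _ _ ?_
          rw [hw, inv_mul_cancel_right] }
    have hN : N = ⊤ := by
      refine hgen N (fun c x => ?_) (fun x => ?_)
      · by_cases hx : x ◃ gen c = x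
        · intro m
          rw [hψε c x hx, hmul, hmul, horbit, hact, hx]
          refine hinv _ _ _ ?_
          rw [horbit]
          simp
        · rw [hε' c x hx]
          exact one_mem N
      · intro m
        rw [hψσ, hmul, htrans]
        refine hinv _ _ _ ?_
        rw [horbit, mul_inv_cancel_right]
    intro w
    have : w ∈ N := by rw [hN]; trivial
    exact this
  -- The pair (m, x) stands for the group element `ψ m * trans x`, and the action becomes right
  -- multiplication. This gives surjectivity onto H, and `hψ_act` gives injectivity.
  have hF : ∀ g y, ψ (act g y).1 * trans (act g y).2 = ψ y.1 * trans y.2 * g := by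
    intro g
    refine gen_induction (motive := fun g => ∀ y,
      ψ (act g y).1 * trans (act g y).2 = ψ y.1 * trans y.2 * g) g ?_ ?_ ?_ ?_
    · rintro c ⟨m, x⟩
      have hε'' : ψ (ε c x) = orbitTrans c x * gen c * (orbitTrans c (x ◃ gen c))⁻¹ := by
        by_cases hx : x ◃ gen c = x
        · rw [hψε c x hx, hx]
        · rw [hε' c x hx, orbitTrans_cosetMul hx, map_one, mul_inv_cancel]
      rw [hact]
      simp only [map_mul, map_inv, hψσ, hε'']
      group
    · intro y
      rw [hone, mul_one]
    · intro g h hg hh y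
      rw [hmul, hh, hg, mul_assoc]
    · intro g hg y
      have := hg (act g⁻¹ y)
      rw [← hmul, inv_mul_cancel, hone] at this
      rw [this, mul_inv_cancel_right]
  have hmem : ∀ w, ψ w ∈ H := by
    intro w
    rw [← base_cosetMul_eq_base, ← hsnd (ψ w) (1, base H), hψ_act]
  refine ⟨(MulEquiv.ofBijective (ψ.codRestrict H hmem) ⟨?_, ?_⟩).symm⟩
  · intro v w h
    have h1 : ψ v = ψ w := congrArg Subtype.val h
    have h2 := hψ_act v 1
    rw [h1, hψ_act] at h2
    simpa using (congrArg Prod.fst h2).symm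
  · rintro ⟨h, hh⟩
    refine ⟨(act h (1, base H)).1, Subtype.ext ?_⟩
    have := hF h (1, base H)
    rw [hsnd, base_cosetMul_eq_base.2 hh, trans_base] at this
    simpa using this

/-- A subgroup of the modular group is the free product of cyclic groups, one for each fixed point
of a generator on the cosets, and a free group, with one generator for each coset outside of the
tree. -/
theorem nonempty_mulEquiv_freeProductModel {l₂ l₃ r : ℕ}
    (i₂ : Fin l₂ ≃ {x : Cosets H // x ◃ gen Letter.a = x})
    (i₃ : Fin l₃ ≃ {x : Cosets H // x ◃ gen Letter.b = x})
    (i : Fin r ≃ {x : Cosets H // ∀ c, root c x ≠ x}) :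
    Nonempty (H ≃* FreeProductModel l₂ l₃ r) := by
  classical
  let E₂ (x : Cosets H) : FreeProductModel l₂ l₃ r :=
    if h : x ◃ gen Letter.a = x then
      Coprod.inl (CoprodI.of (i := i₂.symm ⟨x, h⟩) (Multiplicative.ofAdd 1)) else 1
  let E₃ (x : Cosets H) : FreeProductModel l₂ l₃ r :=
    if h : x ◃ gen Letter.b = x then
      Coprod.inr (Coprod.inl (CoprodI.of (i := i₃.symm ⟨x, h⟩) (Multiplicative.ofAdd 1))) else 1
  let S (x : Cosets H) : FreeProductModel l₂ l₃ r :=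
    if h : ∀ c, root c x ≠ x then Coprod.inr (Coprod.inr (FreeGroup.of (i.symm ⟨x, h⟩))) else 1
  let ψ : FreeProductModel l₂ l₃ r →* PSL2Z :=
    Coprod.lift (CoprodI.lift fun j => cyclicLift 2 _ (orbitTrans_conj_pow Letter.a (i₂ j).1))
      (Coprod.lift (CoprodI.lift fun j => cyclicLift 3 _ (orbitTrans_conj_pow Letter.b (i₃ j).1))
        (FreeGroup.lift fun j => trans (i j).1 * (orbitTrans Letter.b (i j).1)⁻¹))
  have hE₂ : ∀ j, E₂ (i₂ j).1 = Coprod.inl (CoprodI.of (i := j) (Multiplicative.ofAdd 1)) := by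
    intro j
    simp only [E₂, dif_pos (i₂ j).2, Subtype.coe_eta, Equiv.symm_apply_apply]
  have hE₃ : ∀ j, E₃ (i₃ j).1 =
      Coprod.inr (Coprod.inl (CoprodI.of (i := j) (Multiplicative.ofAdd 1))) := by
    intro j
    simp only [E₃, dif_pos (i₃ j).2, Subtype.coe_eta, Equiv.symm_apply_apply]
  have hS : ∀ j, S (i j).1 = Coprod.inr (Coprod.inr (FreeGroup.of j)) := by
    intro j
    simp only [S, dif_pos (i j).2, Subtype.coe_eta, Equiv.symm_apply_apply]
  refine nonempty_mulEquiv_of_generators ψ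
    -- As `trans` is adapted to the a-orbits, the free generators are carried by the letter b alone.
    (fun c x => match c with | Letter.a => 1 | Letter.b => S x)
    (fun c x => match c with | Letter.a => E₂ x | Letter.b => E₃ x) ?_ ?_ (fun _ => rfl) ?_ ?_ ?_ ?_
  · rintro (_ | _) x
    · change E₂ x ^ 2 = 1
      by_cases h : x ◃ gen Letter.a = x
      · rw [show E₂ x = _ from dif_pos h, ← map_pow, ← map_pow, ← ofAdd_nsmul]
        simp [show (2 : ZMod 2) = 0 from rfl]
      · rw [show E₂ x = _ from dif_neg h, one_pow]
    · change E₃ x ^ 3 = 1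
      by_cases h : x ◃ gen Letter.b = x
      · rw [show E₃ x = _ from dif_pos h, ← map_pow, ← map_pow, ← map_pow, ← ofAdd_nsmul]
        simp [show (3 : ZMod 3) = 0 from rfl]
      · rw [show E₃ x = _ from dif_neg h, one_pow]
  · rintro (_ | _) x h
    · exact dif_neg h
    · exact dif_neg h
  · rintro (_ | _) c' x h
    · rfl
    · exact dif_neg fun h' => h' c' h
  · rintro (_ | _) x
    · change ψ 1 = _
      rw [map_one, orbitTrans_a, mul_inv_cancel]
    · change ψ (S x) = _
      by_cases h : ∀ c, root c x ≠ x
      · obtain ⟨j, hj⟩ := i.surjective ⟨x, h⟩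
        obtain rfl : (i j).1 = x := congrArg Subtype.val hj
        rw [hS]
        simp [ψ]
      · rw [show S x = _ from dif_neg h, map_one]
        push Not at h
        obtain ⟨c, hc⟩ := h
        rw [orbitTrans_of_root_eq hc, mul_inv_cancel]
  · rintro (_ | _) x h
    · change ψ (E₂ x) = _
      obtain ⟨j, hj⟩ := i₂.surjective ⟨x, h⟩
      obtain rfl : (i₂ j).1 = x := congrArg Subtype.val hj
      rw [hE₂]
      simp only [ψ, Coprod.lift_apply_inl, CoprodI.lift_of]
      exact cyclicLift_one _ _ _
    · change ψ (E₃ x) = _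
      obtain ⟨j, hj⟩ := i₃.surjective ⟨x, h⟩
      obtain rfl : (i₃ j).1 = x := congrArg Subtype.val hj
      rw [hE₃]
      simp only [ψ, Coprod.lift_apply_inl, Coprod.lift_apply_inr, CoprodI.lift_of]
      exact cyclicLift_one _ _ _
  · intro N hN hN'
    have zmem : ∀ {K : Type} [Group K] (n : ℕ) (f : Multiplicative (ZMod n) →* K) (N : Subgroup K),
        f (Multiplicative.ofAdd 1) ∈ N → ∀ y, f y ∈ N := by
      intro K _ n f N hf y
      obtain ⟨k, hk⟩ := ZMod.intCast_surjective (Multiplicative.toAdd y)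
      have hy : y = (Multiplicative.ofAdd (1 : ZMod n)) ^ k := by
        rw [← ofAdd_zsmul]; simp [hk]
      rw [hy, map_zpow]
      exact zpow_mem hf k
    rw [eq_top_iff]
    rintro w -
    induction w using Coprod.induction_on with
    | inl w =>
      induction w using CoprodI.induction_on with
      | one => rw [map_one]; exact one_mem N
      | of j y =>
        refine zmem 2 (Coprod.inl.comp
          (CoprodI.of (M := fun _ : Fin l₂ => Multiplicative (ZMod 2)) (i := j))) N ?_ y
        rw [MonoidHom.comp_apply, ← hE₂ j]
        exact hN Letter.a _
      | mul v w hv hw => rw [map_mul]; exact mul_mem hv hw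
    | inr w =>
      induction w using Coprod.induction_on with
      | inl w =>
        induction w using CoprodI.induction_on with
        | one => rw [map_one, map_one]; exact one_mem N
        | of j y =>
          refine zmem 3 ((Coprod.inr.comp Coprod.inl).comp
            (CoprodI.of (M := fun _ : Fin l₃ => Multiplicative (ZMod 3)) (i := j))) N ?_ y
          have := hN Letter.b (i₃ j).1
          change E₃ (i₃ j).1 ∈ N at this
          rwa [hE₃ j] at this
        | mul v w hv hw => rw [map_mul, map_mul]; exact mul_mem hv hw
      | inr w =>
        induction w using FreeGroup.induction_on with
        | C1 => rw [map_one, map_one]; exact one_mem N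
        | of j =>
          have := hN' (i j).1
          change S (i j).1 ∈ N at this
          rwa [hS j] at this
        | inv_of j hj => rw [map_inv, map_inv]; exact inv_mem hj
        | mul v w hv hw => rw [map_mul, map_mul]; exact mul_mem hv hw
      | mul v w hv hw => rw [map_mul]; exact mul_mem hv hw
    | mul v w hv hw => exact mul_mem hv hw

end ModularSubgroups

/-! ### Roots, connectedness and cyclic reducedness of the Stallings graph. -/

namespace ModularSubgroups

open LabeledGraph

variable {H : Subgroup PSL2Z}

theorem Reach.cases {c : Letter} {p : Cosets H} (hp : Reach c p) (hb : p ≠ base H) :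
    ∃ c' e, c' ≠ c ∧ Reach c' (p ◃ letterValue (c', e)) := by
  obtain ⟨u, hu, hlast, rfl⟩ := hp
  rcases List.eq_nil_or_concat' u with rfl | ⟨u, ⟨c', e⟩, rfl⟩
  · simp at hb
  · obtain ⟨h1, h2, -⟩ := hu.parts
    refine ⟨c', !e, by simpa using hlast, u, h1, h2, ?_⟩
    rw [letterValue_not, ← cosetMul_mul]
    simp

/-- Otherwise some c^{±1}-step would lead nearer to the base inside the same orbit. -/
theorem reach_root (c : Letter) (x : Cosets H) : Reach c (root c x) := by
  by_contra h
  obtain ⟨e, he⟩ := exists_lt_of_not_reach h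
  exact (root_ne_of_dist_lt he).2 (root_root c x)

theorem reach_of_fixed {c : Letter} {x : Cosets H} (hx : x ◃ gen c = x) : Reach c x := by
  have := reach_root c x
  rcases mem_genOrbit_iff.1 (root_mem c x) with h | h | h
  · rwa [h] at this
  · rwa [h, hx] at this
  · rwa [h, ← cosetMul_eq_iff.1 hx] at this

/-- If the c'-root were another point, it would satisfy `Reach c'`, and a c'-step from it to x would
give `Reach c x`. Hence cosets outside Γ(H) yield no free generators. -/
theorem root_eq_of_not_reach {c c' : Letter} {x : Cosets H} (hx : ¬ Reach c x) (hc : c' ≠ c) :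
    root c' x = x := by
  have h := reach_root c' x
  rcases mem_genOrbit_iff.1 (root_mem c' x) with h1 | h1 | h1
  · exact h1
  · have := h.step hc false
    rw [h1, letterValue_false, cosetMul_cosetMul_inv] at this
    exact (hx this).elim
  · have := h.step hc true
    rw [h1, letterValue_true, cosetMul_inv_cosetMul] at this
    exact (hx this).elim

theorem root_eq_of_mem_genOrbit {c : Letter} {x y : Cosets H} (h : y ∈ genOrbit c x) :
    root c y = root c x := by
  rcases mem_genOrbit_iff.1 h with rfl | rfl | rfl <;> simp

theorem genOrbit_eq_of_mem {c : Letter} {x y : Cosets H} (h : y ∈ genOrbit c x) :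
    genOrbit c y = genOrbit c x := by
  rcases mem_genOrbit_iff.1 h with rfl | rfl | rfl
  · rfl
  · exact genOrbit_cosetMul c x
  · rw [← genOrbit_cosetMul, cosetMul_inv_cosetMul]

theorem mem_genOrbit_of_root_eq {c : Letter} {x y : Cosets H} (h : root c y = root c x) :
    y ∈ genOrbit c x := by
  rw [← genOrbit_eq_of_mem (root_mem c x), ← h, genOrbit_eq_of_mem (root_mem c y)]
  exact mem_genOrbit_self c y

/-- The number of base vertices not adjacent to a `c`-edge. -/
noncomputable def baseDefect (H : Subgroup PSL2Z) (c : Letter) : ℕ :=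
  open Classical in if (stallingsGraph H).IsAdjacent c (base H) then 0 else 1

theorem stallings_isAdjacent {c : Letter} {p : Cosets H} :
    (stallingsGraph H).IsAdjacent c p ↔
      Reach c p ∧ (Reach c (p ◃ gen c) ∨ Reach c (p ◃ (gen c)⁻¹)) := by
  simp only [IsAdjacent, stallings_edge]
  constructor
  · rintro ⟨q, ⟨rfl, h1, h2⟩ | ⟨rfl, h1, h2⟩⟩
    · exact ⟨h1, .inl h2⟩
    · exact ⟨h2, .inr (by rwa [cosetMul_cosetMul_inv])⟩
  · rintro ⟨h1, h2 | h2⟩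
    · exact ⟨_, .inl ⟨rfl, h1, h2⟩⟩
    · exact ⟨_, .inr ⟨(cosetMul_inv_cosetMul _ _).symm, h2, h1⟩⟩

theorem IsAdjacent.mem_verts {c : Letter} {p : Cosets H}
    (h : (stallingsGraph H).IsAdjacent c p) : p ∈ (stallingsGraph H).verts := by
  obtain ⟨q, h | h⟩ := h
  · exact (stallingsGraph H).left_mem h
  · exact (stallingsGraph H).right_mem h

/-- A word to p that does not end in the other letter is nonempty, so it ends in c^{±1}; its last
step is the required edge. -/
theorem isAdjacent_of_ne_base {p : Cosets H} (hp : p ∈ (stallingsGraph H).verts)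
    (hb : p ≠ base H) (c : Letter) : (stallingsGraph H).IsAdjacent c p := by
  rw [stallings_verts] at hp
  rw [stallings_isAdjacent]
  obtain ⟨c₀, hc₀⟩ := exists_ne c
  obtain ⟨c', e, hc', h⟩ := (hp c₀).cases hb
  obtain rfl : c' = c := by
    rcases c with _ | _ <;> rcases c' with _ | _ <;> rcases c₀ with _ | _ <;> simp_all
  refine ⟨hp c', ?_⟩
  cases e
  · exact .inr h
  · exact .inl h

theorem base_mem_verts : base H ∈ (stallingsGraph H).verts :=
  stallings_verts.2 fun c => reach_base c

/-- Every vertex of the Stallings graph but the base is joined by an edge to a vertex nearer to the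
base. -/
theorem exists_edge_pred {p : Cosets H} (hp : p ∈ (stallingsGraph H).verts) (hb : p ≠ base H) :
    ∃ c q, dist q < dist p ∧ q ∈ (stallingsGraph H).verts ∧
      ((stallingsGraph H).edge c p q ∨ (stallingsGraph H).edge c q p) := by
  obtain ⟨c, e, q, hq, hqp, hlt⟩ := exists_pred hb
  have hpc := stallings_verts.1 hp c
  cases e
  · have h : (stallingsGraph H).edge c p q := stallings_edge.2
      ⟨by rw [← hqp, letterValue_false, cosetMul_inv_cosetMul], hpc, hq⟩
    exact ⟨c, q, hlt, (stallingsGraph H).right_mem h, .inl h⟩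
  · have h : (stallingsGraph H).edge c q p := stallings_edge.2 ⟨hqp.symm, hq, hpc⟩
    exact ⟨c, q, hlt, (stallingsGraph H).left_mem h, .inr h⟩

theorem stallings_isConnected : (stallingsGraph H).IsConnected := by
  refine ⟨⟨_, base_mem_verts⟩, ?_⟩
  have key : ∀ p ∈ (stallingsGraph H).verts,
      Relation.EqvGen (fun x y => ∃ c, (stallingsGraph H).edge c x y) p (base H) := by
    intro p hp
    induction hk : dist p using Nat.strong_induction_on generalizing p with | _ k ih
    subst hk
    by_cases hb : p = base H
    · rw [hb]
      exact .refl _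
    · obtain ⟨c, q, hlt, hq, h | h⟩ := exists_edge_pred hp hb
      · exact .trans _ _ _ (.rel _ _ ⟨c, h⟩) (ih _ hlt _ hq rfl)
      · exact .trans _ _ _ (.symm _ _ (.rel _ _ ⟨c, h⟩)) (ih _ hlt _ hq rfl)
  exact fun p hp q hq => .trans _ _ _ (key p hp) (.symm _ _ (key q hq))

theorem stallings_isReduced (hfin : (stallingsGraph H).verts.Finite) {v : Cosets H}
    (hv : v ∈ (stallingsGraph H).verts)
    (hadj : ∀ p ∈ (stallingsGraph H).verts, p ≠ v → ∀ c, (stallingsGraph H).IsAdjacent c p) :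
    (stallingsGraph H).IsReduced v where
  base_mem := hv
  finite := hfin
  connected := stallings_isConnected
  freelyReduced := by
    simp only [IsFreelyReduced, stallings_edge]
    constructor
    · rintro c p _ _ ⟨rfl, -⟩ ⟨rfl, -⟩
      rfl
    · rintro c _ q r ⟨rfl, -⟩ ⟨h, -⟩
      exact cosetMul_left_injective _ h
  a_symm := by
    simp only [stallings_edge]
    rintro p _ ⟨rfl, h1, h2⟩
    exact ⟨by rw [← cosetMul_mul, gen_a_mul_self, cosetMul_one], h2, h1⟩
  b_triangle := by
    simp only [stallings_edge]
    rintro p _ _ ⟨rfl, h1, h2⟩ ⟨rfl, h3, h4⟩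
    refine ⟨?_, h4, h1⟩
    rw [← cosetMul_mul, ← cosetMul_mul, gen_b_mul_self, mul_inv_cancel, cosetMul_one]
  adjacent p hp hpv := ⟨hadj p hp hpv _, hadj p hp hpv _⟩

/-- Only the base can lack an edge of some label. With a second vertex available as root, the
adjacency condition applies to the base too. -/
theorem stallings_isCyclicallyReduced_iff (hn : 2 ≤ (stallingsGraph H).verts.ncard) :
    (stallingsGraph H).IsCyclicallyReduced ↔
      ∀ c, (stallingsGraph H).IsAdjacent c (base H) := by
  -- An infinite set has `ncard` 0, so the bound on `ncard` gives finiteness.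
  have hfin : (stallingsGraph H).verts.Finite := Set.finite_of_ncard_pos (by omega)
  constructor
  · rintro ⟨-, h⟩
    obtain ⟨v, hv, hne⟩ := Set.exists_ne_of_one_lt_ncard hn (base H)
    have := (h v hv).adjacent (base H) base_mem_verts hne.symm
    rintro (_ | _)
    · exact this.1
    · exact this.2
  · intro h
    refine ⟨⟨_, base_mem_verts⟩, fun v hv => stallings_isReduced hfin hv fun p hp _ c => ?_⟩
    by_cases hb : p = base H
    · rw [hb]
      exact h c
    · exact isAdjacent_of_ne_base hp hb c

theorem exists_isAdjacent_base (hn : 2 ≤ (stallingsGraph H).verts.ncard) :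
    ∃ c, (stallingsGraph H).IsAdjacent c (base H) := by
  obtain ⟨p, hp, hb⟩ := Set.exists_ne_of_one_lt_ncard hn (base H)
  induction hk : dist p using Nat.strong_induction_on generalizing p with | _ k ih
  subst hk
  obtain ⟨c, q, hlt, hq, h⟩ := exists_edge_pred hp hb
  by_cases hqb : q = base H
  · subst hqb
    exact ⟨c, p, h.symm⟩
  · exact ih _ hlt q hq hqb rfl

/-- A fixed coset is its own root and so satisfies `Reach c`: Γ(H) contains every loop of the
Schreier graph, and ℓ₂, ℓ₃ count all the fixed points. -/
theorem stallings_loops (c : Letter) : (stallingsGraph H).loops c = {x | x ◃ gen c = x} := by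
  ext x
  simp only [loops, stallings_edge, Set.mem_ofPred_eq]
  exact ⟨fun h => h.1.symm, fun h => ⟨h.symm, reach_of_fixed h, reach_of_fixed h⟩⟩

/-! ### Counting vertices, roots and orbits. -/

section Counting

theorem ncard_verts (hfin : (stallingsGraph H).verts.Finite) (c : Letter) :
    (stallingsGraph H).verts.ncard =
      {x | (stallingsGraph H).IsAdjacent c x}.ncard + baseDefect H c := by
  by_cases h : (stallingsGraph H).IsAdjacent c (base H)
  · rw [baseDefect, if_pos h, add_zero]
    congr 1
    ext x
    refine ⟨fun hx => ?_, fun hx => IsAdjacent.mem_verts hx⟩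
    by_cases hb : x = base H
    · subst hb; exact h
    · exact isAdjacent_of_ne_base hx hb c
  · rw [baseDefect, if_neg h, ← Set.ncard_insert_of_notMem (a := base H)
      (s := {x | (stallingsGraph H).IsAdjacent c x}) h
      (hfin.subset fun x hx => IsAdjacent.mem_verts hx)]
    congr 1
    ext x
    refine ⟨fun hx => ?_, ?_⟩
    · by_cases hb : x = base H
      · exact .inl hb
      · exact .inr (isAdjacent_of_ne_base hx hb c)
    · rintro (rfl | hx)
      · exact base_mem_verts
      · exact IsAdjacent.mem_verts hx

theorem ncard_roots (hfin : (stallingsGraph H).verts.Finite) (c : Letter) :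
    {x ∈ (stallingsGraph H).verts | root c x = x}.ncard =
      {x | (stallingsGraph H).IsAdjacent c x ∧ root c x = x}.ncard + baseDefect H c := by
  by_cases h : (stallingsGraph H).IsAdjacent c (base H)
  · rw [baseDefect, if_pos h, add_zero]
    congr 1
    ext x
    refine ⟨fun hx => ⟨?_, hx.2⟩, fun hx => ⟨IsAdjacent.mem_verts hx.1, hx.2⟩⟩
    by_cases hb : x = base H
    · subst hb; exact h
    · exact isAdjacent_of_ne_base hx.1 hb c
  · rw [baseDefect, if_neg h, ← Set.ncard_insert_of_notMem (a := base H) (fun h' => h h'.1)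
      (hfin.subset fun x hx => IsAdjacent.mem_verts hx.1)]
    congr 1
    ext x
    refine ⟨fun hx => ?_, ?_⟩
    · by_cases hb : x = base H
      · exact .inl hb
      · exact .inr ⟨isAdjacent_of_ne_base hx.1 hb c, hx.2⟩
    · rintro (rfl | hx)
      · exact ⟨base_mem_verts, root_base c⟩
      · exact ⟨IsAdjacent.mem_verts hx.1, hx.2⟩

/-- Counting the generators outside of the tree. -/
theorem ncard_nonroots (hfin : (stallingsGraph H).verts.Finite) :
    {x : Cosets H | ∀ c, root c x ≠ x}.ncard +
      ({x ∈ (stallingsGraph H).verts | root Letter.a x = x}.ncard +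
        {x ∈ (stallingsGraph H).verts | root Letter.b x = x}.ncard) =
      (stallingsGraph H).verts.ncard + 1 := by
  have hR : ∀ c, {x ∈ (stallingsGraph H).verts | root c x = x}.Finite :=
    fun c => hfin.subset fun x hx => hx.1
  rw [← Set.ncard_union_add_ncard_inter _ _ (hR _) (hR _)]
  have h1 : {x ∈ (stallingsGraph H).verts | root Letter.a x = x} ∩
      {x ∈ (stallingsGraph H).verts | root Letter.b x = x} = {base H} := by
    ext x
    constructor
    · rintro ⟨⟨-, ha⟩, -, hb⟩
      refine eq_base_of_root_eq fun c => ?_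
      cases c
      · exact ha
      · exact hb
    · rintro rfl
      exact ⟨⟨base_mem_verts, root_base _⟩, base_mem_verts, root_base _⟩
  -- Cosets outside Γ(H) are roots for some letter, so the count may be confined to the finite
  -- vertex set.
  have h2 : {x : Cosets H | ∀ c, root c x ≠ x} = (stallingsGraph H).verts \
      ({x ∈ (stallingsGraph H).verts | root Letter.a x = x} ∪
      {x ∈ (stallingsGraph H).verts | root Letter.b x = x}) := by
    ext x
    constructor
    · intro hx
      refine ⟨?_, ?_⟩
      · rw [stallings_verts]
        intro c
        by_contra h
        obtain ⟨c', hc'⟩ := exists_ne c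
        exact hx c' (root_eq_of_not_reach h hc')
      · rintro (h | h)
        · exact hx _ h.2
        · exact hx _ h.2
    · rintro ⟨hx, h⟩ (_ | _) h'
      · exact h (.inl ⟨hx, h'⟩)
      · exact h (.inr ⟨hx, h'⟩)
  rw [h1, Set.ncard_singleton, h2, ← add_assoc]
  congr 1
  exact Set.ncard_sdiff_add_ncard_of_subset
    (Set.union_subset (fun x hx => hx.1) (fun x hx => hx.1)) hfin

/-- A finite set of cosets, stable under taking roots, with orbits of constant size. -/
theorem ncard_eq_mul_ncard_roots {c : Letter} {S : Set (Cosets H)} (hS : S.Finite) {k : ℕ}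
    (horb : ∀ x ∈ S, genOrbit c x ⊆ S) (hcard : ∀ x ∈ S, (genOrbit c x).ncard = k) :
    S.ncard = k * {x ∈ S | root c x = x}.ncard := by
  classical
  have hR : {x ∈ S | root c x = x}.Finite := hS.subset fun x hx => hx.1
  rw [Set.ncard_eq_toFinset_card _ hS, Set.ncard_eq_toFinset_card _ hR,
    Finset.card_eq_sum_card_fiberwise (f := root c) (t := hR.toFinset), Finset.sum_const_nat (m := k),
    mul_comm]
  · intro x hx
    rw [Set.Finite.mem_toFinset] at hx
    rw [← hcard x hx.1, ← Set.ncard_coe_finset]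
    congr 1
    ext y
    simp only [Finset.coe_filter, Set.Finite.mem_toFinset, Set.mem_ofPred_eq]
    constructor
    · rintro ⟨hy, h⟩
      exact mem_genOrbit_of_root_eq (h.trans hx.2.symm)
    · intro hy
      exact ⟨horb x hx.1 hy, (root_eq_of_mem_genOrbit hy).trans hx.2⟩
  · intro x hx
    simp only [Set.Finite.coe_toFinset] at hx ⊢
    exact ⟨horb x hx (root_mem c x), root_root c x⟩

/-- Each orbit contains exactly one root. -/
theorem ncard_genOrbit_image {c : Letter} {S : Set (Cosets H)}
    (horb : ∀ x ∈ S, genOrbit c x ⊆ S) :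
    (genOrbit c '' S).ncard = {x ∈ S | root c x = x}.ncard := by
  have h : genOrbit c '' S = genOrbit c '' {x ∈ S | root c x = x} := by
    refine subset_antisymm ?_ (Set.image_mono fun x hx => hx.1)
    rintro _ ⟨x, hx, rfl⟩
    exact ⟨root c x, ⟨horb x hx (root_mem c x), root_root c x⟩, genOrbit_eq_of_mem (root_mem c x)⟩
  rw [h]
  refine Set.InjOn.ncard_image ?_
  intro x hx y hy hxy
  have hy' : y ∈ genOrbit c x := by
    rw [show genOrbit c x = genOrbit c y from hxy]
    exact mem_genOrbit_self c y
  rw [← hx.2, ← hy.2]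
  exact (root_eq_of_mem_genOrbit hy').symm

end Counting

end ModularSubgroups

/-! ### Edges and triangles of the Stallings graph as orbits. -/

namespace ModularSubgroups

open LabeledGraph

variable {H : Subgroup PSL2Z}

theorem cosetMul_gen_a_gen_a (x : Cosets H) : x ◃ gen Letter.a ◃ gen Letter.a = x := by
  rw [← cosetMul_mul, gen_a_mul_self, cosetMul_one]

theorem cosetMul_gen_b_gen_b (x : Cosets H) :
    x ◃ gen Letter.b ◃ gen Letter.b = x ◃ (gen Letter.b)⁻¹ := by
  rw [← cosetMul_mul, gen_b_mul_self]

theorem cosetMul_gen_b_inv_gen_b_inv (x : Cosets H) :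
    x ◃ (gen Letter.b)⁻¹ ◃ (gen Letter.b)⁻¹ = x ◃ gen Letter.b := by
  rw [← cosetMul_mul, gen_b_inv_mul_self]

theorem genOrbit_a (x : Cosets H) : genOrbit Letter.a x = {x, x ◃ gen Letter.a} := by
  ext y
  simp [mem_genOrbit_iff, gen_a_inv]

theorem genOrbit_b (x : Cosets H) :
    genOrbit Letter.b x = {x, x ◃ gen Letter.b, x ◃ (gen Letter.b)⁻¹} := by
  ext y
  simp [mem_genOrbit_iff]

theorem cosetMul_gen_ne {c : Letter} {x : Cosets H} (hx : x ◃ gen c ≠ x) :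
    x ◃ gen c ◃ gen c ≠ x ◃ gen c := fun h => hx (cosetMul_left_injective _ h)

theorem cosetMul_gen_inv_ne {c : Letter} {x : Cosets H} (hx : x ◃ gen c ≠ x) :
    x ◃ (gen c)⁻¹ ≠ x := fun h => hx (by rw [cosetMul_eq_iff]; exact h.symm)

theorem cosetMul_gen_b_ne_inv {x : Cosets H} (hx : x ◃ gen Letter.b ≠ x) :
    x ◃ gen Letter.b ≠ x ◃ (gen Letter.b)⁻¹ := fun h => by
  rw [← cosetMul_gen_b_gen_b] at h
  exact cosetMul_gen_ne hx h.symm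

/-- The vertices of the isolated `a`-edges. -/
def pairVerts (H : Subgroup PSL2Z) : Set (Cosets H) :=
  {x | x ◃ gen Letter.a ≠ x ∧ Reach Letter.a x ∧ Reach Letter.a (x ◃ gen Letter.a)}

/-- The vertices of the `b`-triangles. -/
def triangleVerts (H : Subgroup PSL2Z) : Set (Cosets H) :=
  {x | x ◃ gen Letter.b ≠ x ∧ ∀ y ∈ genOrbit Letter.b x, Reach Letter.b y}

/-- The initial vertices of the isolated `b`-edges. -/
def isolatedSources (H : Subgroup PSL2Z) : Set (Cosets H) :=
  {x | x ◃ gen Letter.b ≠ x ∧ Reach Letter.b x ∧ Reach Letter.b (x ◃ gen Letter.b) ∧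
    ¬ Reach Letter.b (x ◃ (gen Letter.b)⁻¹)}

/-- The final vertices of the isolated `b`-edges. -/
def isolatedTargets (H : Subgroup PSL2Z) : Set (Cosets H) :=
  {x | x ◃ gen Letter.b ≠ x ∧ Reach Letter.b x ∧ Reach Letter.b (x ◃ (gen Letter.b)⁻¹) ∧
    ¬ Reach Letter.b (x ◃ gen Letter.b)}

theorem isolatedAEdges_eq : (stallingsGraph H).isolatedAEdges = genOrbit Letter.a '' pairVerts H := by
  ext s
  simp only [isolatedAEdges, stallings_edge]
  constructor
  · rintro ⟨p, _, hne, ⟨rfl, h1, h2⟩, -, rfl⟩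
    exact ⟨p, ⟨hne.symm, h1, h2⟩, genOrbit_a p⟩
  · rintro ⟨p, ⟨hne, h1, h2⟩, rfl⟩
    exact ⟨p, _, hne.symm, ⟨rfl, h1, h2⟩, ⟨(cosetMul_gen_a_gen_a p).symm, h2, h1⟩, genOrbit_a p⟩

theorem bTriangles_eq : (stallingsGraph H).bTriangles = genOrbit Letter.b '' triangleVerts H := by
  ext s
  simp only [bTriangles, stallings_edge]
  constructor
  · rintro ⟨p, _, _, hne, -, -, ⟨rfl, h1, h2⟩, ⟨rfl, -, h3⟩, -, rfl⟩
    rw [cosetMul_gen_b_gen_b] at h3 ⊢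
    refine ⟨p, ⟨hne.symm, fun y hy => ?_⟩, genOrbit_b p⟩
    rcases mem_genOrbit_iff.1 hy with rfl | rfl | rfl
    exacts [h1, h2, h3]
  · rintro ⟨p, ⟨hne, h⟩, rfl⟩
    have h1 := h _ (mem_genOrbit_iff.2 (.inl rfl))
    have h2 := h _ (mem_genOrbit_iff.2 (.inr (.inl rfl)))
    have h3 := h _ (mem_genOrbit_iff.2 (.inr (.inr rfl)))
    exact ⟨p, _, _, hne.symm, cosetMul_gen_b_ne_inv hne, cosetMul_gen_inv_ne hne, ⟨rfl, h1, h2⟩,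
      ⟨(cosetMul_gen_b_gen_b p).symm, h2, h3⟩, ⟨(cosetMul_inv_cosetMul _ _).symm, h3, h1⟩,
      genOrbit_b p⟩

theorem isolatedBEdges_eq :
    (stallingsGraph H).isolatedBEdges = (fun x => (x, x ◃ gen Letter.b)) '' isolatedSources H := by
  ext ⟨p, q⟩
  simp only [isolatedBEdges, stallings_edge]
  constructor
  · rintro ⟨⟨h0, h1, h2⟩, hne, h⟩
    dsimp only at h0 h1 h2 hne h
    subst h0
    refine ⟨p, ⟨hne.symm, h1, h2, fun h3 => h ?_⟩, rfl⟩
    exact ⟨_, cosetMul_gen_inv_ne hne.symm, (cosetMul_gen_b_ne_inv hne.symm).symm,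
      ⟨(cosetMul_gen_b_gen_b p).symm, h2, h3⟩, (cosetMul_inv_cosetMul _ _).symm, h3, h1⟩
  · rintro ⟨x, ⟨hne, h1, h2, h3⟩, h⟩
    obtain ⟨rfl, rfl⟩ := Prod.mk.inj h
    refine ⟨⟨rfl, h1, h2⟩, hne.symm, ?_⟩
    rintro ⟨_, -, -, ⟨rfl, -, h4⟩, -⟩
    dsimp only at h4
    rw [cosetMul_gen_b_gen_b] at h4
    exact h3 h4

theorem ncard_isolatedBEdges :
    (stallingsGraph H).isolatedBEdges.ncard = (isolatedSources H).ncard := by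
  rw [isolatedBEdges_eq]
  exact Set.ncard_image_of_injective _ fun x y h => (Prod.mk.inj h).1

theorem isolatedTargets_eq :
    isolatedTargets H = (fun x => x ◃ gen Letter.b) '' isolatedSources H := by
  ext x
  constructor
  · rintro ⟨hne, h1, h2, h3⟩
    refine ⟨x ◃ (gen Letter.b)⁻¹, ⟨?_, h2, ?_, ?_⟩, cosetMul_inv_cosetMul _ _⟩
    · rw [cosetMul_inv_cosetMul]
      exact (cosetMul_gen_inv_ne hne).symm
    · rwa [cosetMul_inv_cosetMul]
    · rwa [cosetMul_gen_b_inv_gen_b_inv]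
  · rintro ⟨x, ⟨hne, h1, h2, h3⟩, rfl⟩
    exact ⟨cosetMul_gen_ne hne, h2, by rwa [cosetMul_cosetMul_inv],
      by rwa [cosetMul_gen_b_gen_b]⟩

theorem ncard_isolatedTargets : (isolatedTargets H).ncard = (isolatedSources H).ncard := by
  rw [isolatedTargets_eq]
  exact Set.ncard_image_of_injective _ (cosetMul_left_injective _)

theorem adjacent_a_eq : {x | (stallingsGraph H).IsAdjacent Letter.a x} =
    (stallingsGraph H).loops Letter.a ∪ pairVerts H := by
  ext x
  rw [stallings_loops]
  constructor
  · intro h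
    rw [Set.mem_ofPred_eq, stallings_isAdjacent, gen_a_inv, or_self] at h
    by_cases hx : x ◃ gen Letter.a = x
    · exact .inl hx
    · exact .inr ⟨hx, h⟩
  · rw [Set.mem_ofPred_eq, stallings_isAdjacent]
    rintro (hx | ⟨-, h1, h2⟩)
    · have h := reach_of_fixed hx
      exact ⟨h, .inl (by rwa [show x ◃ gen Letter.a = x from hx])⟩
    · exact ⟨h1, .inl h2⟩

/-- A b-orbit meeting a b-edge of Γ(H) is a fixed point, or has three points of which three (a
triangle) or two (an isolated edge) satisfy `Reach`. -/
theorem adjacent_b_eq : {x | (stallingsGraph H).IsAdjacent Letter.b x} =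
    (stallingsGraph H).loops Letter.b ∪
      (triangleVerts H ∪ (isolatedSources H ∪ isolatedTargets H)) := by
  ext x
  rw [stallings_loops]
  constructor
  · intro h
    rw [Set.mem_ofPred_eq, stallings_isAdjacent] at h
    obtain ⟨h1, h2⟩ := h
    by_cases hx : x ◃ gen Letter.b = x
    · exact .inl hx
    · by_cases h3 : Reach Letter.b (x ◃ gen Letter.b)
      · by_cases h4 : Reach Letter.b (x ◃ (gen Letter.b)⁻¹)
        · refine .inr (.inl ⟨hx, fun y hy => ?_⟩)
          rcases mem_genOrbit_iff.1 hy with rfl | rfl | rfl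
          exacts [h1, h3, h4]
        · exact .inr (.inr (.inl ⟨hx, h1, h3, h4⟩))
      · exact .inr (.inr (.inr ⟨hx, h1, h2.resolve_left h3, h3⟩))
  · rw [Set.mem_ofPred_eq, stallings_isAdjacent]
    rintro (hx | ⟨-, h⟩ | ⟨-, h1, h2, -⟩ | ⟨-, h1, h2, -⟩)
    · have h := reach_of_fixed hx
      exact ⟨h, .inl (by rwa [show x ◃ gen Letter.b = x from hx])⟩
    · exact ⟨h _ (mem_genOrbit_iff.2 (.inl rfl)), .inl (h _ (mem_genOrbit_iff.2 (.inr (.inl rfl))))⟩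
    · exact ⟨h1, .inl h2⟩
    · exact ⟨h1, .inr h2⟩

theorem genOrbit_subset_pairVerts (x : Cosets H) (hx : x ∈ pairVerts H) :
    genOrbit Letter.a x ⊆ pairVerts H := by
  obtain ⟨hne, h1, h2⟩ := hx
  rw [genOrbit_a]
  rintro _ (rfl | rfl)
  · exact ⟨hne, h1, h2⟩
  · exact ⟨cosetMul_gen_ne hne, h2, by rwa [cosetMul_gen_a_gen_a]⟩

theorem ncard_genOrbit_pairVerts (x : Cosets H) (hx : x ∈ pairVerts H) :
    (genOrbit Letter.a x).ncard = 2 := by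
  rw [genOrbit_a, Set.ncard_pair hx.1.symm]

theorem genOrbit_subset_triangleVerts (x : Cosets H) (hx : x ∈ triangleVerts H) :
    genOrbit Letter.b x ⊆ triangleVerts H := by
  obtain ⟨hne, h⟩ := hx
  intro y hy
  refine ⟨?_, fun z hz => h z (by rwa [genOrbit_eq_of_mem hy] at hz)⟩
  rcases mem_genOrbit_iff.1 hy with rfl | rfl | rfl
  · exact hne
  · exact cosetMul_gen_ne hne
  · rw [cosetMul_inv_cosetMul]
    exact (cosetMul_gen_inv_ne hne).symm

theorem ncard_genOrbit_triangleVerts (x : Cosets H) (hx : x ∈ triangleVerts H) :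
    (genOrbit Letter.b x).ncard = 3 := by
  rw [genOrbit_b, Set.ncard_eq_three]
  exact ⟨_, _, _, hx.1.symm, (cosetMul_gen_inv_ne hx.1).symm, cosetMul_gen_b_ne_inv hx.1, rfl⟩

/-- Each isolated `b`-edge has exactly one root. -/
theorem ncard_isolated_roots :
    {x ∈ isolatedSources H ∪ isolatedTargets H | root Letter.b x = x}.ncard =
      (isolatedSources H).ncard := by
  -- A source is sent to the root of its orbit. This is the source or the target of the edge, since
  -- the third point of the orbit does not satisfy `Reach`.
  symm
  refine Set.ncard_congr (fun x _ => root Letter.b x) ?_ ?_ ?_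
  · intro x hx
    refine ⟨?_, root_root _ _⟩
    have hr := reach_root Letter.b x
    rcases mem_genOrbit_iff.1 (root_mem Letter.b x) with h | h | h
    · rw [h]
      exact .inl hx
    · rw [h, isolatedTargets_eq]
      exact .inr ⟨x, hx, rfl⟩
    · rw [h] at hr
      exact (hx.2.2.2 hr).elim
  · intro x y hx hy hxy
    rcases mem_genOrbit_iff.1 (mem_genOrbit_of_root_eq hxy) with h | h | h
    · exact h
    · refine (hx.2.2.2 ?_).elim
      rw [h, cosetMul_cosetMul_inv]
      exact hy.2.1
    · refine (hy.2.2.2 ?_).elim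
      rw [← h]
      exact hx.2.1
  · rintro z ⟨hz | hz, hzr⟩
    · exact ⟨z, hz, hzr⟩
    · rw [isolatedTargets_eq] at hz
      obtain ⟨x, hx, rfl⟩ := hz
      exact ⟨x, hx, by rw [← root_cosetMul]; exact hzr⟩

theorem root_eq_of_fixed {c : Letter} {x : Cosets H} (hx : x ◃ gen c = x) : root c x = x := by
  rcases mem_genOrbit_iff.1 (root_mem c x) with h | h | h
  · exact h
  · rw [h, hx]
  · rw [h, ← cosetMul_eq_iff.1 hx]

theorem setOf_adjacent_root {c : Letter} {S : Set (Cosets H)}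
    (h : {x | (stallingsGraph H).IsAdjacent c x} = (stallingsGraph H).loops c ∪ S) :
    {x | (stallingsGraph H).IsAdjacent c x ∧ root c x = x} =
      (stallingsGraph H).loops c ∪ {x ∈ S | root c x = x} := by
  ext x
  have hx : (stallingsGraph H).IsAdjacent c x ↔ x ∈ (stallingsGraph H).loops c ∪ S := by
    rw [← h]; rfl
  have hl : x ∈ (stallingsGraph H).loops c → root c x = x := by
    rw [stallings_loops]
    exact root_eq_of_fixed
  change _ ∧ _ ↔ _ ∨ _ ∧ _
  rw [hx]
  change (_ ∨ _) ∧ _ ↔ _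
  tauto

theorem ncard_adjacent_a (hfin : (stallingsGraph H).verts.Finite) :
    {x | (stallingsGraph H).IsAdjacent Letter.a x}.ncard =
      ((stallingsGraph H).loops Letter.a).ncard + 2 * (stallingsGraph H).isolatedAEdges.ncard ∧
    {x | (stallingsGraph H).IsAdjacent Letter.a x ∧ root Letter.a x = x}.ncard =
      ((stallingsGraph H).loops Letter.a).ncard + (stallingsGraph H).isolatedAEdges.ncard := by
  have hf : {x | (stallingsGraph H).IsAdjacent Letter.a x}.Finite :=
    hfin.subset fun x hx => IsAdjacent.mem_verts hx
  have hf1 : ((stallingsGraph H).loops Letter.a).Finite :=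
    hf.subset (by rw [adjacent_a_eq]; exact Set.subset_union_left)
  have hf2 : (pairVerts H).Finite :=
    hf.subset (by rw [adjacent_a_eq]; exact Set.subset_union_right)
  have hd : Disjoint ((stallingsGraph H).loops Letter.a) (pairVerts H) := by
    rw [stallings_loops]
    exact Set.disjoint_left.2 fun x h1 h2 => h2.1 h1
  constructor
  · rw [adjacent_a_eq, Set.ncard_union_eq hd hf1 hf2, isolatedAEdges_eq,
      ncard_genOrbit_image genOrbit_subset_pairVerts,
      ncard_eq_mul_ncard_roots hf2 genOrbit_subset_pairVerts ncard_genOrbit_pairVerts]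
  · rw [setOf_adjacent_root adjacent_a_eq, Set.ncard_union_eq
      (hd.mono_right fun x hx => hx.1) hf1 (hf2.subset fun x hx => hx.1),
      isolatedAEdges_eq, ncard_genOrbit_image genOrbit_subset_pairVerts]

theorem ncard_adjacent_b (hfin : (stallingsGraph H).verts.Finite) :
    {x | (stallingsGraph H).IsAdjacent Letter.b x}.ncard =
      ((stallingsGraph H).loops Letter.b).ncard + (3 * (stallingsGraph H).bTriangles.ncard +
        2 * (stallingsGraph H).isolatedBEdges.ncard) ∧
    {x | (stallingsGraph H).IsAdjacent Letter.b x ∧ root Letter.b x = x}.ncard =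
      ((stallingsGraph H).loops Letter.b).ncard + ((stallingsGraph H).bTriangles.ncard +
        (stallingsGraph H).isolatedBEdges.ncard) := by
  have hf : {x | (stallingsGraph H).IsAdjacent Letter.b x}.Finite :=
    hfin.subset fun x hx => IsAdjacent.mem_verts hx
  have hf' := hf
  rw [adjacent_b_eq, Set.finite_union, Set.finite_union, Set.finite_union] at hf'
  obtain ⟨hf1, hf2, hf3, hf4⟩ := hf'
  have hd1 : Disjoint (isolatedSources H) (isolatedTargets H) :=
    Set.disjoint_left.2 fun x h1 h2 => h1.2.2.2 h2.2.2.1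
  have hd2 : Disjoint (triangleVerts H) (isolatedSources H ∪ isolatedTargets H) := by
    refine Set.disjoint_left.2 fun x h1 h2 => ?_
    rcases h2 with h2 | h2
    · exact h2.2.2.2 (h1.2 _ (mem_genOrbit_iff.2 (.inr (.inr rfl))))
    · exact h2.2.2.2 (h1.2 _ (mem_genOrbit_iff.2 (.inr (.inl rfl))))
  have hd3 : Disjoint ((stallingsGraph H).loops Letter.b)
      (triangleVerts H ∪ (isolatedSources H ∪ isolatedTargets H)) := by
    rw [stallings_loops]
    refine Set.disjoint_left.2 fun x h1 h2 => ?_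
    rcases h2 with h2 | h2 | h2
    · exact h2.1 h1
    · exact h2.1 h1
    · exact h2.1 h1
  constructor
  · rw [adjacent_b_eq, Set.ncard_union_eq hd3 hf1 (hf2.union (hf3.union hf4)),
      Set.ncard_union_eq hd2 hf2 (hf3.union hf4), Set.ncard_union_eq hd1 hf3 hf4,
      ncard_isolatedTargets, ← ncard_isolatedBEdges, bTriangles_eq,
      ncard_genOrbit_image genOrbit_subset_triangleVerts,
      ncard_eq_mul_ncard_roots hf2 genOrbit_subset_triangleVerts ncard_genOrbit_triangleVerts,
      two_mul]
  · have h : {x ∈ triangleVerts H ∪ (isolatedSources H ∪ isolatedTargets H) | root Letter.b x = x} =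
        {x ∈ triangleVerts H | root Letter.b x = x} ∪
          {x ∈ isolatedSources H ∪ isolatedTargets H | root Letter.b x = x} := by
      ext x
      exact or_and_right
    have hs : {x ∈ isolatedSources H ∪ isolatedTargets H | root Letter.b x = x} ⊆
      isolatedSources H ∪ isolatedTargets H := fun x hx => hx.1
    have hs' : {x ∈ triangleVerts H | root Letter.b x = x} ⊆ triangleVerts H := fun x hx => hx.1
    rw [setOf_adjacent_root adjacent_b_eq, Set.ncard_union_eq (hd3.mono_right fun x hx => hx.1) hf1
      ((hf2.union (hf3.union hf4)).subset fun x hx => hx.1), h,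
      Set.ncard_union_eq (hd2.mono hs' hs) (hf2.subset hs') ((hf3.union hf4).subset hs),
      ncard_isolated_roots, ← ncard_isolatedBEdges, bTriangles_eq,
      ncard_genOrbit_image genOrbit_subset_triangleVerts]

/-- A subgroup of finite index has no isolated `b`-edges. -/
theorem isolatedBEdges_eq_empty (hH : H.FiniteIndex) :
    (stallingsGraph H).isolatedBEdges = ∅ := by
  have : Finite (Cosets H) :=
    Finite.of_equiv _ (QuotientGroup.quotientRightRelEquivQuotientLeftRel H).symm
  have hab : Letter.a ≠ Letter.b := by simp
  -- Translation by a maps A into B and translation by b⁻¹ maps B into A, both injectively. On a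
  -- finite set of cosets the second map is therefore onto A.
  let A : Set (Cosets H) := {x | Reach Letter.a x}
  let B : Set (Cosets H) := {x | Reach Letter.b x}
  have h1 : (fun x => x ◃ gen Letter.a) '' A ⊆ B := by
    rintro _ ⟨x, hx, rfl⟩
    exact Reach.step hx hab true
  have h2 : (fun x => x ◃ (gen Letter.b)⁻¹) '' B ⊆ A := by
    rintro _ ⟨x, hx, rfl⟩
    exact Reach.step hx hab.symm false
  have h3 : (fun x => x ◃ (gen Letter.b)⁻¹) '' B = A := by
    refine Set.eq_of_subset_of_ncard_le h2 ?_ (Set.toFinite _)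
    rw [Set.ncard_image_of_injective _ (cosetMul_left_injective _),
      ← Set.ncard_image_of_injective A (cosetMul_left_injective (gen Letter.a))]
    exact Set.ncard_le_ncard h1 (Set.toFinite _)
  rw [isolatedBEdges_eq, Set.image_eq_empty, Set.eq_empty_iff_forall_notMem]
  rintro x ⟨-, hx, -, hx'⟩
  -- A preimage y of x b under translation by b⁻¹ is x b² = x b⁻¹, so the third point of the orbit
  -- would satisfy `Reach` as well.
  have hA : x ◃ gen Letter.b ∈ A := hx.step hab.symm true
  rw [← h3] at hA
  obtain ⟨y, hy, hyx⟩ := hA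
  apply hx'
  rw [show y = x ◃ (gen Letter.b)⁻¹ by
    rw [← cosetMul_gen_b_gen_b, ← show y ◃ (gen Letter.b)⁻¹ = _ from hyx, cosetMul_inv_cosetMul]] at hy
  exact hy

end ModularSubgroups

/-! ### The rank formula and the conclusion. -/

namespace ModularSubgroups

/-- The isomorphism with the model, and its rank in terms of the combinatorial type. -/
theorem exists_mulEquiv_rank {H : Subgroup PSL2Z} {n k₂ k₃ l₂ l₃ m : ℕ}
    (htype : (stallingsGraph H).combinatorialType = ⟨n, k₂, k₃, l₂, l₃, m⟩) (hn : 2 ≤ n) :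
    ∃ r : ℕ, Nonempty (H ≃* FreeProductModel l₂ l₃ r) ∧
      (r : ℚ) = ((n : ℚ) - 2 * k₃ - 3 * l₂ - 4 * l₃) / 6 + 1 -
        (baseDefect H Letter.a / 2 + 2 * baseDefect H Letter.b / 3) := by
  obtain ⟨rfl, rfl, rfl, rfl, rfl, rfl⟩ := CombinatorialType.mk.inj htype
  have hfin : (stallingsGraph H).verts.Finite := Set.finite_of_ncard_pos (by omega)
  have hloops : ∀ c, ((stallingsGraph H).loops c).Finite := fun c =>
    hfin.subset fun x hx => (stallingsGraph H).left_mem hx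
  have hE : {x : Cosets H | ∀ c, root c x ≠ x}.Finite := hfin.subset fun x hx => by
    rw [stallings_verts]
    intro c
    by_contra h
    obtain ⟨c', hc'⟩ := exists_ne c
    exact hx c' (root_eq_of_not_reach h hc')
  have hfix : ∀ c, Nonempty (Fin ((stallingsGraph H).loops c).ncard ≃
      {x : Cosets H // x ◃ gen c = x}) := by
    intro c
    have h := hloops c
    rw [stallings_loops] at h ⊢
    have := h.to_subtype
    exact ⟨(Finite.equivFin _).symm.trans (Equiv.subtypeEquivRight fun x => Iff.rfl)⟩
  have hfree : Nonempty (Fin {x : Cosets H | ∀ c, root c x ≠ x}.ncard ≃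
      {x : Cosets H // ∀ c, root c x ≠ x}) := by
    have := hE.to_subtype
    exact ⟨(Finite.equivFin _).symm.trans (Equiv.subtypeEquivRight fun x => Iff.rfl)⟩
  obtain ⟨i₂⟩ := hfix Letter.a
  obtain ⟨i₃⟩ := hfix Letter.b
  obtain ⟨i⟩ := hfree
  refine ⟨_, nonempty_mulEquiv_freeProductModel i₂ i₃ i, ?_⟩
  have h0 := ncard_nonroots hfin
  rw [ncard_roots hfin Letter.a, ncard_roots hfin Letter.b, (ncard_adjacent_a hfin).2,
    (ncard_adjacent_b hfin).2] at h0
  have ha := ncard_verts hfin Letter.a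
  have hb := ncard_verts hfin Letter.b
  rw [(ncard_adjacent_a hfin).1] at ha
  rw [(ncard_adjacent_b hfin).1] at hb
  have h0' := congrArg (Nat.cast : ℕ → ℚ) h0
  have ha' := congrArg (Nat.cast : ℕ → ℚ) ha
  have hb' := congrArg (Nat.cast : ℕ → ℚ) hb
  push_cast at h0' ha' hb'
  -- Eliminates k₂ and m from the two vertex counts and the root count.
  linarith

theorem exists_letter_iff {P : Letter → Prop} : (∃ c, P c) ↔ P Letter.a ∨ P Letter.b :=
  ⟨fun ⟨c, hc⟩ => by cases c <;> simp [hc], fun h => h.elim (⟨_, ·⟩) (⟨_, ·⟩)⟩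

theorem forall_letter_iff {P : Letter → Prop} : (∀ c, P c) ↔ P Letter.a ∧ P Letter.b :=
  ⟨fun h => ⟨h _, h _⟩, fun h c => by cases c <;> simp [h]⟩

end ModularSubgroups

theorem mainTheorem10 (H : Subgroup ModularSubgroups.PSL2Z) (hH : H.FG)
    (n k₂ k₃ l₂ l₃ m : ℕ)
    (htype : (ModularSubgroups.stallingsGraph H).combinatorialType = ⟨n, k₂, k₃, l₂, l₃, m⟩)
    (hn : 2 ≤ n) :
    ((ModularSubgroups.stallingsGraph H).IsCyclicallyReduced →
      ModularSubgroups.IsomorphismTypeIs H l₂ l₃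
        (((n : ℚ) - 2 * k₃ - 3 * l₂ - 4 * l₃) / 6 + 1) ∧
      (H.FiniteIndex →
        ModularSubgroups.IsomorphismTypeIs H l₂ l₃ (((n : ℚ) - 3 * l₂ - 4 * l₃) / 6 + 1)) ∧
      (IsFreeGroup H ↔ l₂ = 0 ∧ l₃ = 0) ∧
      (IsFreeGroup H →
        ModularSubgroups.IsFreeOfRank H (((n : ℚ) - 2 * k₃) / 6 + 1) ∧
        (H.FiniteIndex → ModularSubgroups.IsFreeOfRank H ((n : ℚ) / 6 + 1)))) ∧
    (¬ (ModularSubgroups.stallingsGraph H).IsCyclicallyReduced →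
      Xor ((ModularSubgroups.stallingsGraph H).IsAdjacent ModularSubgroups.Letter.a
          (ModularSubgroups.base H))
        ((ModularSubgroups.stallingsGraph H).IsAdjacent ModularSubgroups.Letter.b
          (ModularSubgroups.base H)) ∧
      ((ModularSubgroups.stallingsGraph H).IsAdjacent ModularSubgroups.Letter.a
          (ModularSubgroups.base H) →
        ModularSubgroups.IsomorphismTypeIs H l₂ l₃
          (((n : ℚ) - 2 * k₃ - 3 * l₂ - 4 * l₃) / 6 + 1 / 3)) ∧
      ((ModularSubgroups.stallingsGraph H).IsAdjacent ModularSubgroups.Letter.b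
          (ModularSubgroups.base H) →
        ModularSubgroups.IsomorphismTypeIs H l₂ l₃
          (((n : ℚ) - 2 * k₃ - 3 * l₂ - 4 * l₃) / 6 + 1 / 2)) ∧
      (IsFreeGroup H ↔ l₂ = 0 ∧ l₃ = 0) ∧
      (IsFreeGroup H →
        ((ModularSubgroups.stallingsGraph H).IsAdjacent ModularSubgroups.Letter.a
            (ModularSubgroups.base H) →
          ModularSubgroups.IsFreeOfRank H (((n : ℚ) - 2 * k₃ + 2) / 6)) ∧
        ((ModularSubgroups.stallingsGraph H).IsAdjacent ModularSubgroups.Letter.b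
            (ModularSubgroups.base H) →
          ModularSubgroups.IsFreeOfRank H (((n : ℚ) - 2 * k₃ + 3) / 6)))) := by
  obtain ⟨r, ⟨e⟩, hr⟩ := ModularSubgroups.exists_mulEquiv_rank htype hn
  have hverts : (ModularSubgroups.stallingsGraph H).verts.ncard = n :=
    congrArg ModularSubgroups.CombinatorialType.n htype
  have hk₃ : (ModularSubgroups.stallingsGraph H).isolatedBEdges.ncard = k₃ :=
    congrArg ModularSubgroups.CombinatorialType.k₃ htype
  have hcyc := ModularSubgroups.stallings_isCyclicallyReduced_iff (H := H) (hverts.symm ▸ hn)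
  have hex := ModularSubgroups.exists_isAdjacent_base (H := H) (hverts.symm ▸ hn)
  rw [ModularSubgroups.forall_letter_iff] at hcyc
  rw [ModularSubgroups.exists_letter_iff] at hex
  have hindex : H.FiniteIndex → (k₃ : ℚ) = 0 := by
    intro h
    rw [← hk₃, ModularSubgroups.isolatedBEdges_eq_empty h, Set.ncard_empty, Nat.cast_zero]
  have hiso := fun q => ModularSubgroups.isomorphismTypeIs_of_mulEquiv (r := q) e
  have hfree := ModularSubgroups.isFreeGroup_iff e
  have hrank : ∀ q : ℚ, IsFreeGroup H → (r : ℚ) = q → ModularSubgroups.IsFreeOfRank H q := by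
    intro q h hq
    obtain ⟨rfl, rfl⟩ := hfree.1 h
    exact ModularSubgroups.isFreeOfRank_of_mulEquiv e hq
  have hl : IsFreeGroup H → (l₂ : ℚ) = 0 ∧ (l₃ : ℚ) = 0 := fun h =>
    ⟨by rw [(hfree.1 h).1, Nat.cast_zero], by rw [(hfree.1 h).2, Nat.cast_zero]⟩
  have hδ₀ : ∀ c, (ModularSubgroups.stallingsGraph H).IsAdjacent c (ModularSubgroups.base H) →
      (ModularSubgroups.baseDefect H c : ℚ) = 0 := fun c h => by
    rw [ModularSubgroups.baseDefect, if_pos h, Nat.cast_zero]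
  have hδ₁ : ∀ c, ¬ (ModularSubgroups.stallingsGraph H).IsAdjacent c (ModularSubgroups.base H) →
      (ModularSubgroups.baseDefect H c : ℚ) = 1 := fun c h => by
    rw [ModularSubgroups.baseDefect, if_neg h, Nat.cast_one]
  constructor
  · intro h
    obtain ⟨ha, hb⟩ := hcyc.1 h
    rw [hδ₀ _ ha, hδ₀ _ hb] at hr
    refine ⟨hiso _ (by linarith), fun hi => hiso _ ?_, hfree, fun hf => ⟨hrank _ hf ?_, fun hi =>
      hrank _ hf ?_⟩⟩
    · linarith [hindex hi]
    · linarith [(hl hf).1, (hl hf).2]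
    · linarith [(hl hf).1, (hl hf).2, hindex hi]
  · intro h
    -- The base lacks an edge of some label, while `hex` provides one of some label: exactly one
    -- defect is 1. It subtracts 2/3 from the rank if b is missing and 1/2 if a is missing.
    rw [hcyc, not_and] at h
    have hra : (ModularSubgroups.stallingsGraph H).IsAdjacent ModularSubgroups.Letter.a
        (ModularSubgroups.base H) →
        (r : ℚ) = ((n : ℚ) - 2 * k₃ - 3 * l₂ - 4 * l₃) / 6 + 1 / 3 := by
      intro ha
      rw [hδ₀ _ ha, hδ₁ _ (h ha)] at hr
      linarith
    have hrb : (ModularSubgroups.stallingsGraph H).IsAdjacent ModularSubgroups.Letter.b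
        (ModularSubgroups.base H) →
        (r : ℚ) = ((n : ℚ) - 2 * k₃ - 3 * l₂ - 4 * l₃) / 6 + 1 / 2 := by
      intro hb
      rw [hδ₁ _ fun ha => h ha hb, hδ₀ _ hb] at hr
      linarith
    refine ⟨?_, fun ha => hiso _ (hra ha), fun hb => hiso _ (hrb hb), hfree, fun hf =>
      ⟨fun ha => hrank _ hf ?_, fun hb => hrank _ hf ?_⟩⟩
    · rcases hex with ha | hb
      · exact .inl ⟨ha, h ha⟩
      · exact .inr ⟨hb, fun ha => h ha hb⟩
    · linarith [hra ha, (hl hf).1, (hl hf).2]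
    · linarith [hrb hb, (hl hf).1, (hl hf).2]
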